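/- **System.** An access point serves $M$ stations (STAs). Time is divided into mini-slots $\tau=0,1,2,\dots$, and durations are measured in mini-slots; an epoch consists of $T\ge 1$ mini-slots, epoch $n$ being $\{nT,\dots,nT+T-1\}$. There are TWT intervals $T_1<T_2<\dots<T_L$, where each $T_l<T$ is a positive integer dividing $T$. At the start of each epoch every STA is either assigned one of these intervals or put to sleep for the whole epoch; at most $K$ STAs may be assigned to the same interval. A STA with interval $T_l$ is awake exactly in the mini-slots that are multiples of $T_l$, so it has $N=T/T_l$ sessions in the epoch; a sleeping STA has $N=0$. An awake mini-slot costs energy $E_s=P_d t_d t_{up}+P_u t_u t_{up}$ and any other mini-slot costs $E_{sleep}=P_{sleep}t_{up}$, with $0\le E_{sleep}\le E_s$. So STA $m$ consumes $E_m^n=E_sN+(T-N)E_{sleep}$ in epoch $n$. The transmission rate $R_m(n)$ of STA $m$ (data per mini-slot) is constant during epoch $n$ and takes values in a finite set of nonnegative rates, all at most $R_{max}$. In mini-slot $\tau$, an amount $A_m(\tau)\in[0,A_{max}]$ of data arrives to STA $m$. For each $m$ the $R_m(n)$, $n\ge0$, are identically distributed and the $A_m(\tau)$, $\tau\ge0$,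 are identically distributed with mean $\lambda_m$, and all these random variables (over all STAs and times) are independent. From given deterministic $Q_m(0)\ge 0$, the queues evolve by $$Q_m(\tau+1)=\max[Q_m(\tau)-R_m(\lfloor \tau/T\rfloor)\mathbf 1\{m\text{ awake in }\tau\},0]+A_m(\tau).$$ **Algorithms.** An algorithm chooses the assignment of epoch $n$, subject to the constraint above, from the arrivals before epoch $n$, the rates up to and including epoch $n$, and possibly a randomization independent of all arrivals and rates. It stabilizes the network if $\limsup_{S\to\infty}\frac1S\sum_{\tau<S}\mathbb E[Q_m(\tau)]<\infty$ for every $m$. The capacity region $\Lambda\subset\mathbb R^M$ is the set of mean arrival vectors of (nonnegative, finite-mean) arrival processes, independent across STAs and time, identically distributed over time and independent of the rates, for which some algorithm stabilizes the network. For the given arrivals, $E^*_{avg}$ is the infimum, over all algorithms that stabilize the network, of $E_{avg}=\limsup_{N\to\infty}\frac1N\sum_{n<N}\sum_{m=1}^M\mathbb E[E_m^n]$. **JTWSA** with parameter $V>0$: at time $t=nT$, sort the STAs by decreasing weight $Q_m(t)R_m(n)-V(E_s-E_{sleep})$ (ties broken in any way that obeys the information constraint above). Among the first $L\times K$ of them,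 those with positive weight get intervals according to their position: the first $K$ get $T_1$, the next $K$ get $T_2$, and so on. All other STAs sleep during the epoch. **Theorem 1 (Lyapunov Optimization).** If $\boldsymbol\lambda$ is an interior point of $\Lambda$, then there is $\epsilon>0$ with $\boldsymbol\lambda+\boldsymbol\epsilon\in\Lambda$, where $\boldsymbol\epsilon=(\epsilon,\dots,\epsilon)$. For every $\epsilon>0$ with $\boldsymbol\lambda+\boldsymbol\epsilon\in\Lambda$, the energy minimization problem is feasible ($E^*_{avg}<\infty$), and under JTWSA $$\limsup_{N\to\infty}\frac1N\sum_{n=0}^{N-1}\sum_{m=1}^M\mathbb E[E_m^n]\le E^*_{avg}+\frac{B_2}{V},\qquad \limsup_{N\to\infty}\frac1N\sum_{n=0}^{N-1}\sum_{m=1}^M\mathbb E[Q_m(nT)]\le\frac{B_2+VE_{max}}{\epsilon},$$ where $B_2=\frac{MT^2(R_{max}^2+A_{max}^2)}2$ and $E_{max}=MTE_s$. -/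

import Mathlib

open MeasureTheory ProbabilityTheory Filter
open scoped ENNReal

universe u

noncomputable section

namespace TWT

/-- The data of an access point serving `M` stations (STAs) with `L` target wake time intervals.
All durations are measured in mini-slots, whose physical length is the length `tup` of a TWT
session. -/
structure System (M L : ℕ) where
  /-- number of mini-slots in an epoch -/
  T : ℕ
  T_pos : 0 < T
  /-- the TWT intervals `T_1 < ... < T_L`, in mini-slots -/
  interval : Fin L → ℕ
  interval_pos : ∀ l, 0 < interval l
  interval_lt : ∀ l, interval l < T
  interval_dvd : ∀ l, interval l ∣ T
  interval_strictMono : StrictMono interval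
  /-- the largest number of STAs that may share a TWT interval -/
  K : ℕ
  /-- power consumption during downlink, uplink and sleep -/
  Pd : ℝ
  Pu : ℝ
  Psleep : ℝ
  /-- length of a TWT session, and the fractions of it used for downlink and uplink -/
  tup : ℝ
  td : ℝ
  tu : ℝ
  sleep_nonneg : 0 ≤ Psleep * tup
  sleep_le_session : Psleep * tup ≤ Pd * (td * tup) + Pu * (tu * tup)
  /-- the finite set of supported data rates -/
  rates : Finset ℝ
  rates_nonneg : ∀ r ∈ rates, 0 ≤ r
  /-- the distribution of the transmission rate of each STA in an epoch -/
  channelLaw : Fin M → Measure ℝ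
  channelLaw_prob : ∀ m, IsProbabilityMeasure (channelLaw m)
  channelLaw_mem : ∀ m, ∀ᵐ r ∂(channelLaw m), r ∈ rates
  /-- the queue lengths at time `0` -/
  q0 : Fin M → ℝ
  q0_nonneg : ∀ m, 0 ≤ q0 m

/-- A control decision for one epoch: STA `m` gets the TWT interval `l` (value `some l`), or sleeps
during the whole epoch (value `none`). -/
abbrev Decision (M L : ℕ) : Type := Fin M → Option (Fin L)

namespace System

variable {M L : ℕ} (S : System M L)

/-- Energy of one TWT session. -/
def Es : ℝ := S.Pd * (S.td * S.tup) + S.Pu * (S.tu * S.tup)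

/-- Energy of one mini-slot spent asleep. -/
def Esleep : ℝ := S.Psleep * S.tup

/-- A STA with assignment `c` is awake in mini-slot `τ` iff `τ` is a multiple of its interval. -/
def Awake (c : Option (Fin L)) (τ : ℕ) : Prop := ∃ l, c = some l ∧ S.interval l ∣ τ

instance (c : Option (Fin L)) (τ : ℕ) : Decidable (S.Awake c τ) :=
  inferInstanceAs (Decidable (∃ l, c = some l ∧ S.interval l ∣ τ))

/-- Number of TWT sessions in an epoch for a STA with assignment `c`. -/
def sessions (c : Option (Fin L)) : ℕ :=
  match c with
  | some l => S.T / S.interval l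
  | none => 0

/-- Energy consumed in mini-slot `τ` by a STA with assignment `c`. -/
def slotEnergy (c : Option (Fin L)) (τ : ℕ) : ℝ := if S.Awake c τ then S.Es else S.Esleep

/-- Energy consumed over an epoch by a STA with assignment `c`. -/
def epochEnergy (c : Option (Fin L)) : ℝ :=
  S.Es * (S.sessions c : ℝ) + ((S.T : ℝ) - (S.sessions c : ℝ)) * S.Esleep

/-- The queue lengths along a sample path: `a m τ` is the amount of data arriving to STA `m` in
mini-slot `τ`, `r m n` its transmission rate (data per mini-slot) in epoch `n`, and `d n` the
decision of epoch `n`, which consists of the mini-slots `n * T, ..., n * T + T - 1`. -/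
def queue (a r : Fin M → ℕ → ℝ) (d : ℕ → Decision M L) : ℕ → Fin M → ℝ
  | 0, m => S.q0 m
  | τ + 1, m =>
      max (queue a r d τ m - if S.Awake (d (τ / S.T) m) τ then r m (τ / S.T) else 0) 0 + a m τ

/-- At most `K` STAs share a TWT interval. -/
def Admissible (d : Decision M L) : Prop :=
  ∀ l : Fin L, (Finset.univ.filter fun m => d m = some l).card ≤ S.K

/-- The weight `Q_m R_m - V (E_s - E_sleep)` of a STA with queue length `q` and rate `r`. -/
def weight (V q r : ℝ) : ℝ := q * r - V * (S.Es - S.Esleep)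

/-- `d` is a decision of JTWSA for the queue lengths `q` and the rates `r`: the STAs are sorted by
decreasing weight (with ties broken in any way; `σ i` is the STA in position `i`, starting from
`0`), and among the first `L * K` of them those with positive weight get intervals, the first `K`
the first interval, the next `K` the second one, and so on. All other STAs sleep. -/
def IsJTWSA (V : ℝ) (q r : Fin M → ℝ) (d : Decision M L) : Prop :=
  ∃ σ : Equiv.Perm (Fin M),
    Antitone (fun i => S.weight V (q (σ i)) (r (σ i))) ∧
    ∀ i : Fin M, d (σ i) =
      if h : (i : ℕ) < S.K * L ∧ 0 < S.weight V (q (σ i)) (r (σ i)) then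
        some ⟨(i : ℕ) / S.K, Nat.div_lt_of_lt_mul h.1⟩
      else none

/-- On `(Ω, μ)`, the arrivals `A` have marginal laws `α`, the rates `R` have the channel laws, and
all of these variables are independent (across STAs and across time). -/
structure IsNetwork (α : Fin M → Measure ℝ) {Ω : Type u} [MeasurableSpace Ω] (μ : Measure Ω)
    (A R : Fin M → ℕ → Ω → ℝ) : Prop where
  prob : IsProbabilityMeasure μ
  measurable_A : ∀ m τ, Measurable (A m τ)
  measurable_R : ∀ m n, Measurable (R m n)
  law_A : ∀ m τ, μ.map (A m τ) = α m
  law_R : ∀ m n, μ.map (R m n) = S.channelLaw m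
  indep : iIndepFun (Sum.elim (fun p : Fin M × ℕ => A p.1 p.2) (fun p : Fin M × ℕ => R p.1 p.2)) μ

/-- What the network has observed when it takes the decision of epoch `n`: all arrivals before the
epoch, and the rates up to and including this epoch. -/
abbrev history {Ω : Type u} (A R : Fin M → ℕ → Ω → ℝ) (n : ℕ) : MeasurableSpace Ω :=
  (⨆ m, ⨆ τ, ⨆ (_ : τ < n * S.T), (borel ℝ).comap (A m τ)) ⊔
    (⨆ m, ⨆ k, ⨆ (_ : k ≤ n), (borel ℝ).comap (R m k))

/-- The decisions `D` are non-anticipative: they are determined by the history and, possibly, by a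
randomization `𝒰` that is independent of all arrivals and rates. -/
def IsCausal {Ω : Type u} [mΩ : MeasurableSpace Ω] (μ : Measure Ω)
    (A R : Fin M → ℕ → Ω → ℝ) (D : ℕ → Ω → Decision M L) : Prop :=
  ∃ 𝒰 : MeasurableSpace Ω, 𝒰 ≤ mΩ ∧
    Indep 𝒰 ((⨆ m, ⨆ τ, (borel ℝ).comap (A m τ)) ⊔ (⨆ m, ⨆ n, (borel ℝ).comap (R m n))) μ ∧
    ∀ n d, MeasurableSet[𝒰 ⊔ S.history A R n] {ω | D n ω = d}

/-- The queue length of STA `m` at mini-slot `τ`, as a random variable. -/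
def Q {Ω : Type u} (A R : Fin M → ℕ → Ω → ℝ) (D : ℕ → Ω → Decision M L) (τ : ℕ) (m : Fin M)
    (ω : Ω) : ℝ :=
  S.queue (fun m τ => A m τ ω) (fun m n => R m n ω) (fun n => D n ω) τ m

/-- Every queue is strongly stable. -/
def IsStable {Ω : Type u} [MeasurableSpace Ω] (μ : Measure Ω)
    (A R : Fin M → ℕ → Ω → ℝ) (D : ℕ → Ω → Decision M L) : Prop :=
  ∀ m, limsup (fun N : ℕ =>
    (∑ τ ∈ Finset.range N, ∫⁻ ω, ENNReal.ofReal (S.Q A R D τ m ω) ∂μ) / (N : ℝ≥0∞)) atTop < ⊤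

/-- The decisions `D` come from a joint scheduling and TWT interval assignment algorithm that obeys
the constraints and stabilizes the network. -/
def IsFeasible {Ω : Type u} [MeasurableSpace Ω] (μ : Measure Ω)
    (A R : Fin M → ℕ → Ω → ℝ) (D : ℕ → Ω → Decision M L) : Prop :=
  S.IsCausal μ A R D ∧ (∀ n ω, S.Admissible (D n ω)) ∧ S.IsStable μ A R D

/-- The time average (per epoch) of the expected total energy consumption. -/
def avgEnergy {Ω : Type u} [MeasurableSpace Ω] (μ : Measure Ω)
    (D : ℕ → Ω → Decision M L) : ℝ≥0∞ :=
  limsup (fun N : ℕ =>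
    (∑ n ∈ Finset.range N, ∑ m, ∫⁻ ω, ENNReal.ofReal (S.epochEnergy (D n ω m)) ∂μ) / (N : ℝ≥0∞))
    atTop

/-- The time average of the expected total queue length at the epoch boundaries. -/
def avgQueue {Ω : Type u} [MeasurableSpace Ω] (μ : Measure Ω)
    (A R : Fin M → ℕ → Ω → ℝ) (D : ℕ → Ω → Decision M L) : ℝ≥0∞ :=
  limsup (fun N : ℕ =>
    (∑ n ∈ Finset.range N, ∑ m, ∫⁻ ω, ENNReal.ofReal (S.Q A R D (n * S.T) m ω) ∂μ) / (N : ℝ≥0∞))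
    atTop

/-- The capacity region: the rate vectors `lam` for which some algorithm stabilizes the network when
the arrivals (with some distribution) have mean `lam`. -/
def capacityRegion : Set (Fin M → ℝ) :=
  {lam | ∃ α : Fin M → Measure ℝ,
    (∀ m, (∀ᵐ x ∂(α m), 0 ≤ x) ∧ Integrable id (α m) ∧ ∫ x, x ∂(α m) = lam m) ∧
    ∃ (Ω : Type u) (_ : MeasurableSpace Ω) (μ : Measure Ω) (A R : Fin M → ℕ → Ω → ℝ)
      (D : ℕ → Ω → Decision M L), S.IsNetwork α μ A R ∧ S.IsFeasible μ A R D}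

/-- The optimal value of the energy minimization problem for arrivals with laws `α`: the infimum of
the average energy over all (possibly randomized) algorithms that obey the constraints and stabilize
the network; it is `⊤` if there is none. -/
def optEnergy (α : Fin M → Measure ℝ) : ℝ≥0∞ :=
  sInf {e | ∃ (Ω : Type u) (_ : MeasurableSpace Ω) (μ : Measure Ω) (A R : Fin M → ℕ → Ω → ℝ)
    (D : ℕ → Ω → Decision M L), S.IsNetwork α μ A R ∧ S.IsFeasible μ A R D ∧ e = S.avgEnergy μ D}

/-- The energy of an epoch is the sum of the energies of its mini-slots. -/
theorem sum_slotEnergy (c : Option (Fin L)) (n : ℕ) :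
    ∑ τ ∈ Finset.Ico (n * S.T) (n * S.T + S.T), S.slotEnergy c τ = S.epochEnergy c := by
  have key : ((Finset.Ico (n * S.T) (n * S.T + S.T)).filter fun τ => S.Awake c τ).card
      = S.sessions c := by
    cases c with
    | none => simp [Awake, sessions]
    | some l =>
      have hper : Function.Periodic (fun τ => S.interval l ∣ τ) S.T := by
        intro τ
        simpa using (Nat.dvd_add_left (S.interval_dvd l))
      have h1 := Nat.filter_Ico_card_eq_of_periodic (n * S.T) S.T _ hper
      have h2 : Nat.count (fun τ => S.interval l ∣ τ) S.T = S.T / S.interval l := by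
        have := Nat.count_modEq_card S.T (S.interval_pos l) 0
        simpa [Nat.modEq_zero_iff_dvd, Nat.mod_eq_zero_of_dvd (S.interval_dvd l)] using this
      simp only [Awake, Option.some.injEq, exists_eq_left', sessions]
      rw [h1, h2]
  have hle : S.sessions c ≤ S.T := by
    cases c with
    | none => simp [sessions]
    | some l => exact Nat.div_le_self _ _
  unfold slotEnergy epochEnergy
  rw [Finset.sum_ite, Finset.sum_const, Finset.sum_const, key, nsmul_eq_mul, nsmul_eq_mul,
    Finset.filter_not, Finset.card_sdiff_of_subset (Finset.filter_subset _ _), key]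
  simp only [Nat.card_Ico, add_tsub_cancel_left]
  rw [Nat.cast_sub hle]
  ring

end System

end TWT

end

/-! The argument is drift-plus-penalty for the Lyapunov function `∑ Q_m² / 2` sampled at epoch
boundaries. Over an epoch, drift plus `V` times energy is at most the constant `B₂`, plus arrival
terms `Q_m * X_m` and a fixed sleeping cost, minus the total weight `value` of the decision
(`drift_le`). A greedy argument at every threshold on the number of sessions shows that JTWSA
maximizes `value` among admissible decisions (`IsJTWSA.value_le`). As the queues at the start of an
epoch are independent of its rates, the expected weight attained is the mean of `meanMaxValue` over
the queues.

The competitor is not a stationary randomized policy but a pair of averages. For a stabilizing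
algorithm, let `s` and `ν` be the averages over the first `n` epochs of the expected service and of
the expected total number of sessions. All decisions are admissible and the rates have the same law
in every epoch, so `∑ q_m s_m - V (E_s - E_sleep) ν ≤ meanMaxValue V q` for every deterministic `q`.
Stability provides arbitrarily large `n` with mean queues at most `δ n`, hence `s_m ≥ T λ_m - δ`,
while the energy computed from `ν` exceeds the average energy by at most `δ`
(`exists_average_service`).

Inserting this in the drift and telescoping gives both bounds. A competitor for `λ + ε` leaves the
negative drift `-(T ε - δ) ∑ E Q_m`, which bounds the queues and makes JTWSA feasible. A competitor
for `λ` itself leaves an error `δ ∑ E Q_m`, whose time average is `O(δ)` by the queue bound; `δ → 0`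
yields the energy bound. -/

namespace TWT

/-! ### Elementary inequalities: antitone sequences and the Lindley recursion. -/

/-- A sum of at most `k` values of a nonnegative antitone sequence is at most the sum of its first
`k` values. -/
theorem sum_le_sum_filter_lt_of_antitone {M : ℕ} {x : Fin M → ℝ} (hx : Antitone x)
    (hx0 : ∀ i, 0 ≤ x i) (B : Finset (Fin M)) (k : ℕ) (hB : B.card ≤ k) :
    ∑ i ∈ B, x i ≤ ∑ i with i.val < k, x i := by
  -- For `k < M` the value `x k` serves as pivot: it dominates every term outside the first `k` and
  -- is dominated by every term inside.
  rcases le_or_gt M k with hk | hk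
  · refine Finset.sum_le_sum_of_subset_of_nonneg (fun i _ => ?_) (fun i _ _ => hx0 i)
    simpa using i.2.trans_le hk
  set I : Finset (Fin M) := Finset.univ.filter fun i : Fin M => i.val < k with hI
  have hIc : I.card = k := by
    have : I = Finset.Iio (⟨k, hk⟩ : Fin M) := by
      ext i
      simp [hI, Fin.lt_def]
    rw [this, Fin.card_Iio]
  have hcard : (B \ I).card ≤ (I \ B).card := by
    have h1 := Finset.card_sdiff_add_card_inter B I
    have h2 := Finset.card_sdiff_add_card_inter I B
    rw [Finset.inter_comm] at h2
    omega
  have h1 : ∑ i ∈ B \ I, x i ≤ (B \ I).card * x ⟨k, hk⟩ := by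
    rw [← nsmul_eq_mul]
    refine Finset.sum_le_card_nsmul _ _ _ fun i hi => hx ?_
    simpa [hI, Fin.le_def] using (Finset.mem_sdiff.1 hi).2
  have h2 : (I \ B).card * x ⟨k, hk⟩ ≤ ∑ i ∈ I \ B, x i := by
    rw [← nsmul_eq_mul]
    refine Finset.card_nsmul_le_sum _ _ _ fun i hi => hx ?_
    have := (Finset.mem_sdiff.1 hi).1
    simp only [hI, Finset.mem_filter, Finset.mem_univ, true_and] at this
    exact this.le
  have h3 : ((B \ I).card : ℝ) * x ⟨k, hk⟩ ≤ (I \ B).card * x ⟨k, hk⟩ :=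
    mul_le_mul_of_nonneg_right (by exact_mod_cast hcard) (hx0 _)
  have h4 := Finset.sum_inter_add_sum_sdiff B I x
  have h5 := Finset.sum_inter_add_sum_sdiff I B x
  rw [Finset.inter_comm] at h5
  linarith

/-- A natural number multiple as a sum over thresholds. -/
theorem natCast_mul_eq_sum_threshold {b T : ℕ} (hb : b ≤ T) (x : ℝ) :
    (b : ℝ) * x = ∑ t ∈ Finset.range T, if t < b then x else 0 := by
  rw [← Finset.sum_filter, Finset.sum_const, nsmul_eq_mul]
  congr 2
  have : (Finset.range T).filter (fun t => t < b) = Finset.range b := by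
    ext t
    simp only [Finset.mem_filter, Finset.mem_range]
    omega
  rw [this, Finset.card_range]

/-- Upper bound for a queue (Lindley recursion) after several slots. -/
theorem lindley_le {q a b : ℕ → ℝ} (h : ∀ τ, q (τ + 1) = max (q τ - b τ) 0 + a τ)
    (ha : ∀ τ, 0 ≤ a τ) (hb : ∀ τ, 0 ≤ b τ) (t k : ℕ) (hq : 0 ≤ q t) :
    q (t + k) ≤ max (q t - ∑ τ ∈ Finset.Ico t (t + k), b τ) 0 + ∑ τ ∈ Finset.Ico t (t + k), a τ := by
  induction k with
  | zero => simp [hq]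
  | succ k ih =>
    rw [← add_assoc, h, Finset.sum_Ico_succ_top (by omega), Finset.sum_Ico_succ_top (by omega)]
    have h1 := hb (t + k)
    have h2 : 0 ≤ ∑ τ ∈ Finset.Ico t (t + k), a τ := Finset.sum_nonneg fun τ _ => ha τ
    rw [← add_assoc]
    refine add_le_add_left (max_le ?_ ?_) _
    · rcases le_total (q t - ∑ τ ∈ Finset.Ico t (t + k), b τ) 0 with h3 | h3
      · rw [max_eq_right h3] at ih
        have := le_max_right (q t - (∑ τ ∈ Finset.Ico t (t + k), b τ + b (t + k))) 0
        linarith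
      · rw [max_eq_left h3] at ih
        have := le_max_left (q t - (∑ τ ∈ Finset.Ico t (t + k), b τ + b (t + k))) 0
        linarith
    · exact add_nonneg (le_max_right _ _) h2

/-- Lower bound for a queue (Lindley recursion) after several slots. -/
theorem le_lindley {q a b : ℕ → ℝ} (h : ∀ τ, q (τ + 1) = max (q τ - b τ) 0 + a τ) (t k : ℕ) :
    q t - ∑ τ ∈ Finset.Ico t (t + k), b τ + ∑ τ ∈ Finset.Ico t (t + k), a τ ≤ q (t + k) := by
  induction k with
  | zero => simp
  | succ k ih =>
    rw [← add_assoc, h, Finset.sum_Ico_succ_top (by omega), Finset.sum_Ico_succ_top (by omega)]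
    have := le_max_left (q (t + k) - b (t + k)) 0
    linarith

/-! ### Sessions, energy, and the greedy maximization of the total weight. -/

namespace System

variable {M L : ℕ} (S : System M L)

theorem sessions_le (c : Option (Fin L)) : S.sessions c ≤ S.T := by
  cases c with
  | none => simp [sessions]
  | some l => exact Nat.div_le_self _ _

/-- The product of interval and session count is the fixed number `T`. Consequently, the intervals
with more than `t` sessions form an initial segment of `Fin L`. -/
theorem sessions_strictAnti {k l : Fin L} (h : k < l) :
    S.sessions (some l) < S.sessions (some k) := by
  have h1 := S.interval_strictMono h
  obtain ⟨a, ha⟩ := S.interval_dvd k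
  obtain ⟨b, hb⟩ := S.interval_dvd l
  have hk := S.interval_pos k
  have hT := S.T_pos
  simp only [sessions]
  have e1 : S.T / S.interval k = a := Nat.div_eq_of_eq_mul_right hk ha
  have e2 : S.T / S.interval l = b := Nat.div_eq_of_eq_mul_right (S.interval_pos l) hb
  rw [e1, e2]
  by_contra! hab
  have hb0 : 0 < b := by
    rcases Nat.eq_zero_or_pos b with h0 | h0
    · simp [h0] at hb; omega
    · exact h0
  have : S.interval k * a < S.interval l * b :=
    (Nat.mul_le_mul_left _ hab).trans_lt (Nat.mul_lt_mul_of_pos_right h1 hb0)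
  omega

/-- Being a multiple of a divisor of `T` is a `T`-periodic property, so every window of length `T`
holds the same number of awake mini-slots. -/
theorem sum_service (c : Option (Fin L)) (n : ℕ) (x : ℝ) :
    ∑ τ ∈ Finset.Ico (n * S.T) (n * S.T + S.T), (if S.Awake c τ then x else 0)
      = S.sessions c * x := by
  rw [← Finset.sum_filter, Finset.sum_const, nsmul_eq_mul]
  congr 2
  cases c with
  | none => simp [Awake, sessions]
  | some l =>
    have hper : Function.Periodic (fun τ => S.interval l ∣ τ) S.T := by
      intro τ
      simpa using (Nat.dvd_add_left (S.interval_dvd l))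
    have h1 := Nat.filter_Ico_card_eq_of_periodic (n * S.T) S.T _ hper
    have h2 : Nat.count (fun τ => S.interval l ∣ τ) S.T = S.T / S.interval l := by
      have := Nat.count_modEq_card S.T (S.interval_pos l) 0
      simpa [Nat.modEq_zero_iff_dvd, Nat.mod_eq_zero_of_dvd (S.interval_dvd l)] using this
    simp only [Awake, Option.some.injEq, exists_eq_left', sessions]
    rw [h1, h2]

theorem Esleep_nonneg : 0 ≤ S.Esleep := S.sleep_nonneg

theorem Esleep_le_Es : S.Esleep ≤ S.Es := S.sleep_le_session

/-- Separates the unavoidable sleeping cost from the surcharge per session; the latter is the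
penalty that enters `weight`. -/
theorem epochEnergy_eq (c : Option (Fin L)) :
    S.epochEnergy c = S.T * S.Esleep + S.sessions c * (S.Es - S.Esleep) := by
  unfold epochEnergy
  ring

theorem epochEnergy_nonneg (c : Option (Fin L)) : 0 ≤ S.epochEnergy c := by
  rw [epochEnergy_eq]
  have := S.Esleep_nonneg
  have := sub_nonneg.2 S.Esleep_le_Es
  positivity

/-- The total weight of the sessions granted by the decision `d`. -/
def value (V : ℝ) (q r : Fin M → ℝ) (d : Decision M L) : ℝ :=
  ∑ m, (S.sessions (d m) : ℝ) * S.weight V (q m) (r m)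

theorem admissible_none : S.Admissible (fun _ => none) := by
  intro l
  simp

open Classical in
/-- The largest total weight of an admissible decision. -/
noncomputable def maxValue (V : ℝ) (q r : Fin M → ℝ) : ℝ :=
  (Finset.univ.filter S.Admissible).sup' ⟨fun _ => none, by simp [S.admissible_none]⟩
    (S.value V q r)

variable {S}

theorem Admissible.value_le_maxValue {d : Decision M L} (hd : S.Admissible d) (V : ℝ)
    (q r : Fin M → ℝ) : S.value V q r d ≤ S.maxValue V q r :=
  Finset.le_sup' (S.value V q r) (by simpa using hd)

/-- Sleeping stations have no sessions, and each interval with more than `t` sessions carries at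
most `K` stations. -/
theorem Admissible.card_threshold_le {d : Decision M L} (hd : S.Admissible d) (t : ℕ) :
    (Finset.univ.filter fun m => t < S.sessions (d m)).card
      ≤ S.K * (Finset.univ.filter fun l => t < S.sessions (some l)).card := by
  have hsub : (Finset.univ.filter fun m => t < S.sessions (d m)) ⊆
      (Finset.univ.filter fun l => t < S.sessions (some l)).biUnion
        fun l => Finset.univ.filter fun m => d m = some l := by
    intro m hm
    simp only [Finset.mem_filter, Finset.mem_univ, true_and, Finset.mem_biUnion] at hm ⊢
    cases hdm : d m with
    | none => simp [hdm, sessions] at hm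
    | some l => exact ⟨l, by rwa [hdm] at hm, rfl⟩
  refine (Finset.card_le_card hsub).trans (Finset.card_biUnion_le.trans ?_)
  rw [mul_comm, ← smul_eq_mul]
  exact Finset.sum_le_card_nsmul _ _ _ fun l _ => hd l

/-- The stations on interval `l` occupy positions in the block of length `K` starting at `l * K`. -/
theorem IsJTWSA.admissible {V : ℝ} {q r : Fin M → ℝ} {d : Decision M L}
    (h : S.IsJTWSA V q r d) : S.Admissible d := by
  obtain ⟨σ, -, hd⟩ := h
  intro l
  have hpos : ∀ m, d m = some l → (σ.symm m : ℕ) ∈ Finset.Ico (l * S.K) (l * S.K + S.K) := by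
    intro m hm
    have h1 := hd (σ.symm m)
    rw [show d (σ (σ.symm m)) = some l by rw [Equiv.apply_symm_apply, hm]] at h1
    split_ifs at h1 with h2
    have h3 := congrArg Fin.val (Option.some.inj h1)
    simp only at h3
    have hK : 0 < S.K := by
      rcases Nat.eq_zero_or_pos S.K with h0 | h0
      · simp [h0] at h2
      · exact h0
    rw [Finset.mem_Ico, h3]
    refine ⟨Nat.div_mul_le_self _ _, ?_⟩
    have := Nat.lt_div_mul_add (a := (σ.symm m : ℕ)) hK
    omega
  calc _ ≤ (Finset.Ico (l * S.K) (l * S.K + S.K)).card := by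
        refine Finset.card_le_card_of_injOn (fun m => (σ.symm m : ℕ)) ?_ ?_
        · intro m hm
          exact hpos m (by simpa using hm)
        · intro a _ b _ hab
          exact σ.symm.injective (Fin.ext hab)
    _ = S.K := by simp

/-- JTWSA maximizes the total weight. -/
theorem IsJTWSA.value_le {V : ℝ} {q r : Fin M → ℝ} {d d' : Decision M L}
    (h : S.IsJTWSA V q r d) (hd' : S.Admissible d') : S.value V q r d' ≤ S.value V q r d := by
  obtain ⟨σ, hσ, hd⟩ := h
  -- Passing to positive parts can only help `d'`, and changes nothing for `d`, which puts every
  -- station of nonpositive weight to sleep.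
  set x : Fin M → ℝ := fun i => max (S.weight V (q (σ i)) (r (σ i))) 0 with hx
  have hxa : Antitone x := fun i j hij => max_le_max (hσ hij) le_rfl
  have hx0 : ∀ i, 0 ≤ x i := fun i => le_max_right _ _
  unfold value
  rw [← Equiv.sum_comp σ, ← Equiv.sum_comp σ
    (fun m => (S.sessions (d m) : ℝ) * S.weight V (q m) (r m))]
  calc ∑ i, (S.sessions (d' (σ i)) : ℝ) * S.weight V (q (σ i)) (r (σ i))
      ≤ ∑ i, (S.sessions (d' (σ i)) : ℝ) * x i :=
        Finset.sum_le_sum fun i _ => mul_le_mul_of_nonneg_left (le_max_left _ _) (by positivity)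
    _ = ∑ t ∈ Finset.range S.T, ∑ i, if t < S.sessions (d' (σ i)) then x i else 0 := by
        rw [Finset.sum_comm]
        exact Finset.sum_congr rfl fun i _ => natCast_mul_eq_sum_threshold (S.sessions_le _) _
    _ ≤ ∑ t ∈ Finset.range S.T, ∑ i, if t < S.sessions (d (σ i)) then x i else 0 := by
        -- At level `t`, with `k` intervals offering more than `t` sessions, `d'` selects at most `K
        -- * k` stations, whereas JTWSA selects at least those of the first `K * k` positions that
        -- have positive weight.
        refine Finset.sum_le_sum fun t _ => ?_
        set k := (Finset.univ.filter fun l => t < S.sessions (some l)).card with hk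
        have h1 := sum_le_sum_filter_lt_of_antitone hxa hx0
          (Finset.univ.filter fun i => t < S.sessions (d' (σ i))) (S.K * k) (by
            refine le_trans (le_of_eq ?_) (hd'.card_threshold_le t)
            refine Finset.card_bij (fun i _ => σ i) (by simp) (by simp) ?_
            intro m hm
            exact ⟨σ.symm m, by simpa using hm, by simp⟩)
        rw [← Finset.sum_filter]
        refine h1.trans ?_
        rw [Finset.sum_filter]
        refine Finset.sum_le_sum fun i _ => ?_
        by_cases hi : (i : ℕ) < S.K * k
        · rw [if_pos hi]
          rcases le_or_gt (S.weight V (q (σ i)) (r (σ i))) 0 with hw | hw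
          · have : x i = 0 := max_eq_right hw
            simp [this]
          · have hkL : k ≤ L := by
              simpa using Finset.card_filter_le (Finset.univ : Finset (Fin L))
                (fun l => t < S.sessions (some l))
            have hiL : (i : ℕ) < S.K * L := hi.trans_le (Nat.mul_le_mul_left _ hkL)
            have hdi := hd i
            rw [dif_pos ⟨hiL, hw⟩] at hdi
            rw [hdi, if_pos]
            -- Otherwise all intervals with more than `t` sessions come strictly before index `i /
            -- K`, so `k ≤ i / K`, contradicting `i < K * k`.
            by_contra! hlt
            have hik : (i : ℕ) / S.K < k := Nat.div_lt_of_lt_mul hi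
            have hle : k ≤ (i : ℕ) / S.K := by
              have hs : (Finset.univ.filter fun l => t < S.sessions (some l)) ⊆
                  Finset.Iio (⟨(i : ℕ) / S.K, Nat.div_lt_of_lt_mul hiL⟩ : Fin L) := by
                intro l hl
                simp only [Finset.mem_filter, Finset.mem_univ, true_and] at hl
                rw [Finset.mem_Iio]
                by_contra! hle
                rcases hle.eq_or_lt with h0 | h0
                · rw [h0] at hlt; omega
                · have := S.sessions_strictAnti h0; omega
              simpa using Finset.card_le_card hs
            omega
        · rw [if_neg hi]
          split_ifs
          · exact hx0 i
          · exact le_rfl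
    _ = ∑ i, (S.sessions (d (σ i)) : ℝ) * x i := by
        rw [Finset.sum_comm]
        exact Finset.sum_congr rfl fun i _ =>
          (natCast_mul_eq_sum_threshold (S.sessions_le _) _).symm
    _ = ∑ i, (S.sessions (d (σ i)) : ℝ) * S.weight V (q (σ i)) (r (σ i)) := by
        refine Finset.sum_congr rfl fun i _ => ?_
        rw [hd i]
        split_ifs with h
        · rw [hx]
          simp only
          rw [max_eq_left h.2.le]
        · simp [sessions]

/-- Whatever the tie-breaking, the attained weight is a function of queues and rates alone; this is
what lets independence be applied later. -/
theorem IsJTWSA.value_eq_maxValue {V : ℝ} {q r : Fin M → ℝ} {d : Decision M L}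
    (h : S.IsJTWSA V q r d) : S.value V q r d = S.maxValue V q r :=
  le_antisymm (h.admissible.value_le_maxValue V q r)
    (Finset.sup'_le _ _ fun _ hd' => h.value_le (by simpa using hd'))

/-! ### Pathwise queue bounds and the Lyapunov drift over an epoch. -/

variable (S)

/-- Decision and rate are constant during the epoch, so the Lindley bound applies with total offered
service `sessions * rate`, as if all service preceded the arrivals. -/
theorem queue_epoch_le {a r : Fin M → ℕ → ℝ} (d : ℕ → Decision M L) (ha : ∀ m τ, 0 ≤ a m τ)
    (hr : ∀ m n, 0 ≤ r m n) (n : ℕ) (m : Fin M) (hq : 0 ≤ S.queue a r d (n * S.T) m) :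
    S.queue a r d ((n + 1) * S.T) m ≤
      max (S.queue a r d (n * S.T) m - S.sessions (d n m) * r m n) 0
        + ∑ τ ∈ Finset.Ico (n * S.T) (n * S.T + S.T), a m τ := by
  have h := lindley_le (q := fun τ => S.queue a r d τ m) (a := a m)
    (b := fun τ => if S.Awake (d (τ / S.T) m) τ then r m (τ / S.T) else 0)
    (fun τ => rfl) (ha m) (fun τ => by split_ifs; exacts [hr _ _, le_rfl]) (n * S.T) S.T hq
  rw [add_one_mul]
  convert h using 4
  rw [← S.sum_service (d n m) n (r m n)]
  refine Finset.sum_congr rfl fun τ hτ => ?_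
  have : τ / S.T = n := by
    rw [Finset.mem_Ico] at hτ
    exact Nat.div_eq_of_lt_le hτ.1 (by rw [add_one_mul]; exact hτ.2)
  rw [this]

theorem le_queue_epoch (a r : Fin M → ℕ → ℝ) (d : ℕ → Decision M L) (n : ℕ) (m : Fin M) :
    S.queue a r d (n * S.T) m - S.sessions (d n m) * r m n
        + ∑ τ ∈ Finset.Ico (n * S.T) (n * S.T + S.T), a m τ
      ≤ S.queue a r d ((n + 1) * S.T) m := by
  have h := le_lindley (q := fun τ => S.queue a r d τ m) (a := a m)
    (b := fun τ => if S.Awake (d (τ / S.T) m) τ then r m (τ / S.T) else 0)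
    (fun τ => rfl) (n * S.T) S.T
  rw [add_one_mul]
  convert h using 3
  rw [← S.sum_service (d n m) n (r m n)]
  refine Finset.sum_congr rfl fun τ hτ => ?_
  have : τ / S.T = n := by
    rw [Finset.mem_Ico] at hτ
    exact Nat.div_eq_of_lt_le hτ.1 (by rw [add_one_mul]; exact hτ.2)
  rw [this]

theorem queue_nonneg {a r : Fin M → ℕ → ℝ} (d : ℕ → Decision M L) (ha : ∀ m τ, 0 ≤ a m τ)
    (τ : ℕ) (m : Fin M) : 0 ≤ S.queue a r d τ m := by
  cases τ with
  | zero => exact S.q0_nonneg m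
  | succ τ => exact add_nonneg (le_max_right _ _) (ha m τ)

theorem queue_add_le {a r : Fin M → ℕ → ℝ} (d : ℕ → Decision M L) {Amax : ℝ}
    (ha : ∀ m τ, 0 ≤ a m τ) (ha' : ∀ m τ, a m τ ≤ Amax)
    (hr : ∀ m n, 0 ≤ r m n) (t k : ℕ) (m : Fin M) :
    S.queue a r d (t + k) m ≤ S.queue a r d t m + k * Amax := by
  have hb : ∀ τ, 0 ≤ (if S.Awake (d (τ / S.T) m) τ then r m (τ / S.T) else 0) :=
    fun τ => by split_ifs; exacts [hr _ _, le_rfl]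
  have hq := S.queue_nonneg (r := r) d ha t m
  have h := lindley_le (q := fun τ => S.queue a r d τ m) (a := a m)
    (fun τ => rfl) (ha m) hb t k hq
  have h1 : ∑ τ ∈ Finset.Ico t (t + k), a m τ ≤ k * Amax := by
    have := Finset.sum_le_card_nsmul (Finset.Ico t (t + k)) (a m) Amax (fun τ _ => ha' m τ)
    simpa using this
  have h2 : 0 ≤ ∑ τ ∈ Finset.Ico t (t + k),
      (if S.Awake (d (τ / S.T) m) τ then r m (τ / S.T) else 0) := Finset.sum_nonneg fun τ _ => hb τ
  refine h.trans (add_le_add (max_le ?_ hq) h1)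
  linarith

/-- The drift of the quadratic Lyapunov function over an epoch. -/
theorem drift_le {a r : Fin M → ℕ → ℝ} (d : ℕ → Decision M L) {Amax Rmax V : ℝ}
    (ha : ∀ m τ, 0 ≤ a m τ) (ha' : ∀ m τ, a m τ ≤ Amax) (hr : ∀ m n, 0 ≤ r m n)
    (hr' : ∀ m n, r m n ≤ Rmax) (n : ℕ) :
    ∑ m, S.queue a r d ((n + 1) * S.T) m ^ 2 / 2 + V * ∑ m, S.epochEnergy (d n m) ≤
      ∑ m, S.queue a r d (n * S.T) m ^ 2 / 2 + M * S.T ^ 2 * (Rmax ^ 2 + Amax ^ 2) / 2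
        + ∑ m, S.queue a r d (n * S.T) m *
            ∑ τ ∈ Finset.Ico (n * S.T) (n * S.T + S.T), a m τ
        + V * (M * S.T * S.Esleep)
        - S.value V (fun m => S.queue a r d (n * S.T) m) (fun m => r m n) (d n) := by
  have key : ∀ m, S.queue a r d ((n + 1) * S.T) m ^ 2 / 2 + V * S.epochEnergy (d n m) ≤
      S.queue a r d (n * S.T) m ^ 2 / 2 + S.T ^ 2 * (Rmax ^ 2 + Amax ^ 2) / 2
        + S.queue a r d (n * S.T) m * ∑ τ ∈ Finset.Ico (n * S.T) (n * S.T + S.T), a m τ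
        + V * (S.T * S.Esleep)
        - S.sessions (d n m) * S.weight V (S.queue a r d (n * S.T) m) (r m n) := by
    intro m
    have hq := S.queue_nonneg (r := r) d ha (n * S.T) m
    have hq' := S.queue_nonneg (r := r) d ha ((n + 1) * S.T) m
    have h := S.queue_epoch_le d ha hr n m hq
    rw [epochEnergy_eq]
    unfold weight
    generalize S.queue a r d ((n + 1) * S.T) m = Q' at *
    generalize S.queue a r d (n * S.T) m = Q at *
    have hA1 : ∑ τ ∈ Finset.Ico (n * S.T) (n * S.T + S.T), a m τ ≤ S.T * Amax := by
      have := Finset.sum_le_card_nsmul (Finset.Ico (n * S.T) (n * S.T + S.T)) (a m) Amax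
        (fun τ _ => ha' m τ)
      simpa using this
    have hA0 : 0 ≤ ∑ τ ∈ Finset.Ico (n * S.T) (n * S.T + S.T), a m τ :=
      Finset.sum_nonneg fun τ _ => ha m τ
    generalize ∑ τ ∈ Finset.Ico (n * S.T) (n * S.T + S.T), a m τ = X at *
    have hN : (S.sessions (d n m) : ℝ) ≤ S.T := by exact_mod_cast S.sessions_le _
    have hY0 : 0 ≤ S.sessions (d n m) * r m n := mul_nonneg (by positivity) (hr m n)
    have hY1 : S.sessions (d n m) * r m n ≤ S.T * Rmax :=
      mul_le_mul hN (hr' m n) (hr m n) (by positivity)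
    have e : (S.sessions (d n m) : ℝ) * (Q * r m n - V * (S.Es - S.Esleep))
        = Q * (S.sessions (d n m) * r m n) - V * (S.sessions (d n m) * (S.Es - S.Esleep)) := by
      ring
    rw [e]
    generalize S.sessions (d n m) * r m n = Y at *
    have hX2 : X ^ 2 ≤ (S.T * Amax) ^ 2 := pow_le_pow_left₀ hA0 hA1 2
    have hY2 : Y ^ 2 ≤ (S.T * Rmax) ^ 2 := pow_le_pow_left₀ hY0 hY1 2
    -- Expanding this square and bounding its parts gives `Q' ^ 2 ≤ Q ^ 2 + X ^ 2 + Y ^ 2 + 2 * Q *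
    -- (X - Y)`; the two squares make up the constant.
    have hQ2 : Q' ^ 2 ≤ (max (Q - Y) 0 + X) ^ 2 := pow_le_pow_left₀ hq' h 2
    have hm2 : (max (Q - Y) 0) ^ 2 ≤ (Q - Y) ^ 2 := by
      rcases le_total (Q - Y) 0 with h0 | h0
      · rw [max_eq_right h0, zero_pow two_ne_zero]; exact sq_nonneg _
      · rw [max_eq_left h0]
    have hm1 : max (Q - Y) 0 ≤ Q := max_le (by linarith) hq
    have hm3 : max (Q - Y) 0 * X ≤ Q * X := mul_le_mul_of_nonneg_right hm1 hA0
    nlinarith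
  have := Finset.sum_le_sum fun m (_ : m ∈ Finset.univ) => key m
  simp only [Finset.sum_add_distrib, Finset.sum_sub_distrib, ← Finset.mul_sum, Finset.sum_const,
    Finset.card_univ, Fintype.card_fin, nsmul_eq_mul] at this
  unfold value
  simp only [Finset.mul_sum] at this ⊢
  linarith

end System

/-! ### Measurability, independence of past and future, integrability. -/

theorem measurable_comp_of_finite {Ω β γ : Type*} [Finite β] [MeasurableSpace γ]
    {m : MeasurableSpace Ω} {D : Ω → β} (hD : ∀ d, MeasurableSet[m] {ω | D ω = d}) (g : β → γ) :
    Measurable[m] (fun ω => g (D ω)) := by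
  intro s _
  have : (fun ω => g (D ω)) ⁻¹' s = ⋃ d ∈ g ⁻¹' s, {ω | D ω = d} := by
    ext ω
    simp
  rw [this]
  exact MeasurableSet.biUnion (Set.to_countable _) fun d _ => hD d

/-- An independent σ-algebra may be added to the past without destroying independence of the
future. -/
theorem indep_sup_left_of_indep_sup {Ω : Type*} {mΩ : MeasurableSpace Ω} {μ : Measure Ω}
    [IsProbabilityMeasure μ] {U P F : MeasurableSpace Ω} (hU : U ≤ mΩ) (hP : P ≤ mΩ) (hF : F ≤ mΩ)
    (h : Indep U (P ⊔ F) μ) (h' : Indep P F μ) : Indep (U ⊔ P) F μ := by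
  -- Intersections `u ∩ p` form a π-system generating `U ⊔ P`, on which the product formula follows
  -- from independence of `U` from `P ⊔ F` and of `P` from `F`.
  refine IndepSets.indep (p1 := {s | ∃ u p, MeasurableSet[U] u ∧ MeasurableSet[P] p ∧ s = u ∩ p})
    (p2 := {s | MeasurableSet[F] s}) (sup_le hU hP) hF ?_ (@MeasurableSpace.isPiSystem_measurableSet _ F) ?_
    (@MeasurableSpace.generateFrom_measurableSet _ F).symm ?_
  · rintro _ ⟨u, p, hu, hp, rfl⟩ _ ⟨u', p', hu', hp', rfl⟩ -
    exact ⟨u ∩ u', p ∩ p', hu.inter hu', hp.inter hp', Set.inter_inter_inter_comm _ _ _ _⟩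
  · apply le_antisymm
    · refine sup_le (fun u hu => ?_) fun p hp => ?_
      · exact MeasurableSpace.measurableSet_generateFrom
          ⟨u, Set.univ, hu, MeasurableSet.univ, (Set.inter_univ _).symm⟩
      · exact MeasurableSpace.measurableSet_generateFrom
          ⟨Set.univ, p, MeasurableSet.univ, hp, (Set.univ_inter _).symm⟩
    · refine MeasurableSpace.generateFrom_le ?_
      rintro _ ⟨u, p, hu, hp, rfl⟩
      exact MeasurableSet.inter ((le_sup_left : U ≤ U ⊔ P) _ hu) ((le_sup_right : P ≤ U ⊔ P) _ hp)
  · rw [IndepSets_iff]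
    rintro _ f ⟨u, p, hu, hp, rfl⟩ hf
    have hp' := (le_sup_left : P ≤ P ⊔ F) _ hp
    have hf' := (le_sup_right : F ≤ P ⊔ F) _ hf
    rw [Indep_iff] at h h'
    rw [Set.inter_assoc, h u (p ∩ f) hu (hp'.inter hf'), h' p f hp hf, h u p hu hp', mul_assoc]

namespace System

variable {M L : ℕ} (S : System M L)

/-- All arrivals before epoch `n` and all rates of the previous epochs. -/
abbrev past {Ω : Type u} (A R : Fin M → ℕ → Ω → ℝ) (n : ℕ) : MeasurableSpace Ω :=
  (⨆ m, ⨆ τ, ⨆ (_ : τ < n * S.T), (borel ℝ).comap (A m τ)) ⊔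
    (⨆ m, ⨆ k, ⨆ (_ : k < n), (borel ℝ).comap (R m k))

/-- All arrivals and rates from epoch `n` on. -/
abbrev future {Ω : Type u} (A R : Fin M → ℕ → Ω → ℝ) (n : ℕ) : MeasurableSpace Ω :=
  (⨆ m, ⨆ τ, ⨆ (_ : n * S.T ≤ τ), (borel ℝ).comap (A m τ)) ⊔
    (⨆ m, ⨆ k, ⨆ (_ : n ≤ k), (borel ℝ).comap (R m k))

/-- The decision of epoch `k` already sees the rates of epoch `k`, hence the strict inequality. -/
theorem history_le_past {Ω : Type u} (A R : Fin M → ℕ → Ω → ℝ) {k n : ℕ} (h : k < n) :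
    S.history A R k ≤ S.past A R n := by
  refine sup_le_sup ?_ ?_
  · refine iSup_mono fun m => iSup_mono fun τ => iSup_mono' fun hτ => ⟨?_, le_rfl⟩
    exact hτ.trans_le (Nat.mul_le_mul_right _ h.le)
  · exact iSup_mono fun m => iSup_mono fun j => iSup_mono' fun hj => ⟨hj.trans_lt h, le_rfl⟩

variable {S} {Ω : Type u} {mΩ : MeasurableSpace Ω} {μ : Measure Ω} {A R : Fin M → ℕ → Ω → ℝ}
  {D : ℕ → Ω → Decision M L} {α : Fin M → Measure ℝ}

theorem measurable_past_A {n τ : ℕ} (m : Fin M) (h : τ < n * S.T) :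
    Measurable[S.past A R n] (A m τ) := by
  rw [measurable_iff_comap_le]
  exact le_sup_of_le_left (le_iSup_of_le m (le_iSup_of_le τ (le_iSup_of_le h le_rfl)))

theorem measurable_past_R {n k : ℕ} (m : Fin M) (h : k < n) :
    Measurable[S.past A R n] (R m k) := by
  rw [measurable_iff_comap_le]
  exact le_sup_of_le_right (le_iSup_of_le m (le_iSup_of_le k (le_iSup_of_le h le_rfl)))

theorem measurable_future_A {n τ : ℕ} (m : Fin M) (h : n * S.T ≤ τ) :
    Measurable[S.future A R n] (A m τ) := by
  rw [measurable_iff_comap_le]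
  exact le_sup_of_le_left (le_iSup_of_le m (le_iSup_of_le τ (le_iSup_of_le h le_rfl)))

theorem measurable_future_R {n k : ℕ} (m : Fin M) (h : n ≤ k) :
    Measurable[S.future A R n] (R m k) := by
  rw [measurable_iff_comap_le]
  exact le_sup_of_le_right (le_iSup_of_le m (le_iSup_of_le k (le_iSup_of_le h le_rfl)))

/-- The queues before epoch `n` are determined by the past and by whatever else the decisions depend
on. -/
theorem measurable_Q_of_decisions {U : MeasurableSpace Ω}
    (hD : ∀ n d, MeasurableSet[U ⊔ S.history A R n] {ω | D n ω = d}) (n τ : ℕ) (hτ : τ ≤ n * S.T)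
    (m : Fin M) : Measurable[U ⊔ S.past A R n] (S.Q A R D τ m) := by
  induction τ with
  | zero => exact measurable_const
  | succ τ ih =>
    have hlt : τ < n * S.T := hτ
    have hdiv : τ / S.T < n := Nat.div_lt_of_lt_mul (by rwa [mul_comm])
    have hA : Measurable[U ⊔ S.past A R n] (A m τ) :=
      (measurable_past_A m hlt).mono le_sup_right le_rfl
    have hR : Measurable[U ⊔ S.past A R n] (R m (τ / S.T)) :=
      (measurable_past_R m hdiv).mono le_sup_right le_rfl
    have hDn : ∀ d, MeasurableSet[U ⊔ S.past A R n] {ω | D (τ / S.T) ω = d} := fun d =>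
      (sup_le_sup le_rfl (S.history_le_past A R hdiv) : U ⊔ S.history A R (τ / S.T) ≤ _) _
        (hD (τ / S.T) d)
    have hg : Measurable[U ⊔ S.past A R n]
        (fun ω => if S.Awake (D (τ / S.T) ω m) τ then (1 : ℝ) else 0) :=
      measurable_comp_of_finite hDn (fun d => if S.Awake (d m) τ then (1 : ℝ) else 0)
    have e : S.Q A R D (τ + 1) m = fun ω => max (S.Q A R D τ m ω -
        (if S.Awake (D (τ / S.T) ω m) τ then (1 : ℝ) else 0) * R m (τ / S.T) ω) 0 + A m τ ω := by
      funext ω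
      simp only [Q, queue, ite_mul, one_mul, zero_mul]
    rw [e]
    exact (((ih hlt.le).sub (hg.mul hR)).max measurable_const).add hA

namespace IsNetwork

theorem comap_A_le (h : S.IsNetwork α μ A R) (m : Fin M) (τ : ℕ) :
    (borel ℝ).comap (A m τ) ≤ mΩ :=
  (h.measurable_A m τ).comap_le

theorem comap_R_le (h : S.IsNetwork α μ A R) (m : Fin M) (n : ℕ) :
    (borel ℝ).comap (R m n) ≤ mΩ :=
  (h.measurable_R m n).comap_le

theorem past_le (h : S.IsNetwork α μ A R) (n : ℕ) : S.past A R n ≤ mΩ :=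
  sup_le (iSup_le fun m => iSup_le fun τ => iSup_le fun _ => h.comap_A_le m τ)
    (iSup_le fun m => iSup_le fun k => iSup_le fun _ => h.comap_R_le m k)

theorem future_le (h : S.IsNetwork α μ A R) (n : ℕ) : S.future A R n ≤ mΩ :=
  sup_le (iSup_le fun m => iSup_le fun τ => iSup_le fun _ => h.comap_A_le m τ)
    (iSup_le fun m => iSup_le fun k => iSup_le fun _ => h.comap_R_le m k)

theorem history_le (h : S.IsNetwork α μ A R) (n : ℕ) : S.history A R n ≤ mΩ :=
  (S.history_le_past A R (Nat.lt_succ_self n)).trans (h.past_le (n + 1))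

/-- Past and future are generated by disjoint subfamilies of one independent family. -/
theorem indep_past_future (h : S.IsNetwork α μ A R) (n : ℕ) :
    Indep (S.past A R n) (S.future A R n) μ := by
  set X : (Fin M × ℕ) ⊕ (Fin M × ℕ) → Ω → ℝ :=
    Sum.elim (fun p : Fin M × ℕ => A p.1 p.2) (fun p : Fin M × ℕ => R p.1 p.2) with hX
  set I : Set ((Fin M × ℕ) ⊕ (Fin M × ℕ)) :=
    {i | Sum.elim (fun p : Fin M × ℕ => p.2 < n * S.T) (fun p : Fin M × ℕ => p.2 < n) i}
  have h1 := indep_iSup_of_disjoint (m := fun i => (borel ℝ).comap (X i)) (fun i => by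
    rcases i with p | p
    · exact h.comap_A_le p.1 p.2
    · exact h.comap_R_le p.1 p.2) ((iIndepFun_iff_iIndep _ _ _).1 h.indep) (disjoint_compl_right (a := I))
  refine indep_of_indep_of_le h1 (sup_le ?_ ?_) (sup_le ?_ ?_)
  · exact iSup_le fun m => iSup_le fun τ => iSup_le fun hτ =>
      le_iSup₂_of_le (Sum.inl (m, τ)) (show τ < n * S.T from hτ) le_rfl
  · exact iSup_le fun m => iSup_le fun k => iSup_le fun hk =>
      le_iSup₂_of_le (Sum.inr (m, k)) (show k < n from hk) le_rfl
  · exact iSup_le fun m => iSup_le fun τ => iSup_le fun hτ =>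
      le_iSup₂_of_le (Sum.inl (m, τ)) (show ¬ τ < n * S.T from not_lt.2 hτ) le_rfl
  · exact iSup_le fun m => iSup_le fun k => iSup_le fun hk =>
      le_iSup₂_of_le (Sum.inr (m, k)) (show ¬ k < n from not_lt.2 hk) le_rfl

theorem ae_A (h : S.IsNetwork α μ A R) {p : ℝ → Prop} (hp : ∀ m, ∀ᵐ x ∂(α m), p x) :
    ∀ᵐ ω ∂μ, ∀ m τ, p (A m τ ω) := by
  refine ae_all_iff.2 fun m => ae_all_iff.2 fun τ => ?_
  have := hp m
  rw [← h.law_A m τ] at this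
  exact ae_of_ae_map (h.measurable_A m τ).aemeasurable this

theorem ae_R (h : S.IsNetwork α μ A R) : ∀ᵐ ω ∂μ, ∀ m n, R m n ω ∈ S.rates := by
  refine ae_all_iff.2 fun m => ae_all_iff.2 fun n => ?_
  have := S.channelLaw_mem m
  rw [← h.law_R m n] at this
  exact ae_of_ae_map (h.measurable_R m n).aemeasurable this

theorem integrable_A (h : S.IsNetwork α μ A R) {m : Fin M} (hα : Integrable id (α m)) (τ : ℕ) :
    Integrable (A m τ) μ := by
  rw [← h.law_A m τ, integrable_map_measure aestronglyMeasurable_id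
    (h.measurable_A m τ).aemeasurable] at hα
  exact hα

theorem integral_A (h : S.IsNetwork α μ A R) (m : Fin M) (τ : ℕ) :
    ∫ ω, A m τ ω ∂μ = ∫ x, x ∂(α m) := by
  rw [← h.law_A m τ]
  exact (integral_map (h.measurable_A m τ).aemeasurable aestronglyMeasurable_id).symm

theorem map_R (h : S.IsNetwork α μ A R) (n : ℕ) :
    μ.map (fun ω m => R m n ω) = Measure.pi S.channelLaw := by
  have h1 : iIndepFun (fun m => R m n) μ :=
    h.indep.precomp (g := fun m : Fin M => Sum.inr (m, n)) fun a b hab => by simpa using hab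
  rw [h1.map_fun_eq_pi_map fun m => (h.measurable_R m n).aemeasurable]
  congr 1
  funext m
  exact h.law_R m n

theorem measurableSet_decision (h : S.IsNetwork α μ A R) (hD : S.IsCausal μ A R D) (n : ℕ)
    (d : Decision M L) : MeasurableSet {ω | D n ω = d} := by
  obtain ⟨U, hU, -, hD⟩ := hD
  exact sup_le hU (h.history_le n) _ (hD n d)

theorem measurable_Q (h : S.IsNetwork α μ A R) (hD : S.IsCausal μ A R D) (τ : ℕ) (m : Fin M) :
    Measurable (S.Q A R D τ m) := by
  obtain ⟨U, hU, -, hD⟩ := hD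
  -- Any epoch starting at or after `τ` would do; epoch number `τ` qualifies since `τ ≤ τ * T`.
  exact (measurable_Q_of_decisions hD τ τ (Nat.le_mul_of_pos_right _ S.T_pos) m).mono
    (sup_le hU (h.past_le τ)) le_rfl

theorem indep_sup_past_future (h : S.IsNetwork α μ A R) {U : MeasurableSpace Ω} (hU : U ≤ mΩ)
    (hUi : Indep U ((⨆ m, ⨆ τ, (borel ℝ).comap (A m τ)) ⊔ (⨆ m, ⨆ n, (borel ℝ).comap (R m n))) μ)
    (n : ℕ) : Indep (U ⊔ S.past A R n) (S.future A R n) μ := by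
  have := @IsNetwork.prob M L S α Ω mΩ μ A R h
  exact indep_sup_left_of_indep_sup hU (h.past_le n) (h.future_le n)
    (indep_of_indep_of_le_right hUi (sup_le
      (sup_le_sup (iSup_mono fun m => iSup_mono fun τ => iSup_le fun _ => le_rfl)
        (iSup_mono fun m => iSup_mono fun τ => iSup_le fun _ => le_rfl))
      (sup_le_sup (iSup_mono fun m => iSup_mono fun τ => iSup_le fun _ => le_rfl)
        (iSup_mono fun m => iSup_mono fun τ => iSup_le fun _ => le_rfl))))
    (h.indep_past_future n)

theorem indepFun_Q_A (h : S.IsNetwork α μ A R) (hD : S.IsCausal μ A R D) {n τ : ℕ}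
    (hτ : n * S.T ≤ τ) (m : Fin M) : IndepFun (S.Q A R D (n * S.T) m) (A m τ) μ := by
  rw [IndepFun_iff_Indep]
  obtain ⟨U, hU, hUi, hD⟩ := hD
  exact indep_of_indep_of_le (h.indep_sup_past_future hU hUi n) (measurable_Q_of_decisions hD n _ le_rfl m).comap_le
    (measurable_future_A m hτ).comap_le

/-- The decision of epoch `n` uses the rates of that epoch, but the queues at its start depend only
on the past and the randomization. -/
theorem indepFun_Q_R (h : S.IsNetwork α μ A R) (hD : S.IsCausal μ A R D) (n : ℕ) :
    IndepFun (fun ω m => S.Q A R D (n * S.T) m ω) (fun ω m => R m n ω) μ := by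
  rw [IndepFun_iff_Indep]
  obtain ⟨U, hU, hUi, hD⟩ := hD
  refine indep_of_indep_of_le (h.indep_sup_past_future hU hUi n) (Measurable.comap_le ?_) (Measurable.comap_le ?_)
  · exact @measurable_pi_lambda _ _ _ (U ⊔ S.past A R n) _ _ fun m => measurable_Q_of_decisions hD n _ le_rfl m
  · exact @measurable_pi_lambda _ _ _ (S.future A R n) _ _ fun m => measurable_future_R m le_rfl

theorem integrable_sessions (h : S.IsNetwork α μ A R) (hD : S.IsCausal μ A R D) (n : ℕ)
    (m : Fin M) : Integrable (fun ω => (S.sessions (D n ω m) : ℝ)) μ := by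
  have := h.prob
  refine Integrable.of_bound (measurable_comp_of_finite (h.measurableSet_decision hD n)
    (fun d => (S.sessions (d m) : ℝ))).aestronglyMeasurable S.T (ae_of_all _ fun ω => ?_)
  simpa using S.sessions_le (D n ω m)

theorem integrable_service (h : S.IsNetwork α μ A R) (hD : S.IsCausal μ A R D) {Rmax : ℝ}
    (hR : ∀ r ∈ S.rates, r ≤ Rmax) (n : ℕ) (m : Fin M) :
    Integrable (fun ω => (S.sessions (D n ω m) : ℝ) * R m n ω) μ := by
  refine (h.integrable_sessions hD n m).mul_bdd (c := Rmax)
    (h.measurable_R m n).aestronglyMeasurable ?_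
  filter_upwards [h.ae_R] with ω hω
  rw [Real.norm_of_nonneg (S.rates_nonneg _ (hω m n))]
  exact hR _ (hω m n)

theorem integrable_Q (h : S.IsNetwork α μ A R) (hD : S.IsCausal μ A R D) {Rmax : ℝ}
    (hR : ∀ r ∈ S.rates, r ≤ Rmax) (hα : ∀ m, Integrable id (α m)) (τ : ℕ) (m : Fin M) :
    Integrable (S.Q A R D τ m) μ := by
  have := h.prob
  induction τ with
  | zero => exact integrable_const _
  | succ τ ih =>
    have hs : Integrable (fun ω =>
        if S.Awake (D (τ / S.T) ω m) τ then R m (τ / S.T) ω else 0) μ := by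
      have e : (fun ω => if S.Awake (D (τ / S.T) ω m) τ then R m (τ / S.T) ω else 0) =
          fun ω => (if S.Awake (D (τ / S.T) ω m) τ then (1 : ℝ) else 0) * R m (τ / S.T) ω := by
        funext ω
        simp
      have hg : Measurable (fun ω => if S.Awake (D (τ / S.T) ω m) τ then (1 : ℝ) else 0) :=
        measurable_comp_of_finite (h.measurableSet_decision hD _)
          (fun d => if S.Awake (d m) τ then (1 : ℝ) else 0)
      refine Integrable.of_bound (C := Rmax) ?_ ?_
      · rw [e]
        exact (hg.mul (h.measurable_R m _)).aestronglyMeasurable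
      · filter_upwards [h.ae_R] with ω hω
        have h0 := S.rates_nonneg _ (hω m (τ / S.T))
        have h1 := hR _ (hω m (τ / S.T))
        split_ifs
        · rwa [Real.norm_of_nonneg h0]
        · simpa using h0.trans h1
    exact ((ih.sub hs).sup (integrable_const (0 : ℝ))).add (h.integrable_A (hα m) τ)

theorem ae_Q_nonneg (h : S.IsNetwork α μ A R) (hα : ∀ m, ∀ᵐ x ∂(α m), 0 ≤ x) :
    ∀ᵐ ω ∂μ, ∀ τ m, 0 ≤ S.Q A R D τ m ω := by
  filter_upwards [h.ae_A hα] with ω hω τ m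
  exact S.queue_nonneg _ hω τ m

end IsNetwork

end System

/-! ### Averages extracted from an arbitrary stabilizing algorithm. -/

/-- If the time averages of a nonnegative sequence stay bounded, then it is small, relative to time,
at arbitrarily large multiples of `T`. -/
theorem exists_ge_le_mul_of_average_le {f : ℕ → ℝ} (hf : ∀ τ, 0 ≤ f τ) {C : ℝ}
    (hC : ∀ᶠ N : ℕ in atTop, ∑ τ ∈ Finset.range N, f τ ≤ C * N) {T : ℕ} (hT : 0 < T) {δ : ℝ}
    (hδ : 0 < δ) (n₀ : ℕ) : ∃ n ≥ n₀, f (n * T) ≤ δ * n := by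
  obtain ⟨N₀, hN₀⟩ := eventually_atTop.1 hC
  -- If `f (j * T)` exceeded `δ * j` for all `j` in `[n, 2n)`, the sum up to `2 * n * T` would be at
  -- least `δ * n ^ 2`, against the bound `2 * C * n * T`; this fails once `n > 2 * C * T / δ`.
  obtain ⟨k, hk⟩ := exists_nat_gt (2 * C * T / δ)
  rw [div_lt_iff₀ hδ] at hk
  set n := max (max n₀ N₀) (k + 1) with hn
  have hn1 : n₀ ≤ n := (le_max_left _ _).trans (le_max_left _ _)
  have hn2 : N₀ ≤ n := (le_max_right _ _).trans (le_max_left _ _)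
  have hn3 : k + 1 ≤ n := le_max_right _ _
  by_contra! hcon
  have h1 : ∑ τ ∈ Finset.range (2 * n * T), f τ ≤ C * (2 * n * T : ℕ) :=
    hN₀ _ (by nlinarith)
  have h2 : ∑ j ∈ Finset.Ico n (2 * n), f (j * T) ≤ ∑ τ ∈ Finset.range (2 * n * T), f τ := by
    rw [← Finset.sum_image (f := f) (g := fun j => j * T)
      (fun a _ b _ hab => Nat.eq_of_mul_eq_mul_right hT hab)]
    refine Finset.sum_le_sum_of_subset_of_nonneg ?_ fun τ _ _ => hf τ
    intro τ hτ
    obtain ⟨j, hj, rfl⟩ := Finset.mem_image.1 hτ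
    exact Finset.mem_range.2 (Nat.mul_lt_mul_of_pos_right (Finset.mem_Ico.1 hj).2 hT)
  have h3 : n * (δ * n) ≤ ∑ j ∈ Finset.Ico n (2 * n), f (j * T) := by
    have := Finset.card_nsmul_le_sum (Finset.Ico n (2 * n)) (fun j => f (j * T)) (δ * n)
      fun j hj => by
        have hj' := (Finset.mem_Ico.1 hj).1
        have : (n : ℝ) ≤ j := by exact_mod_cast hj'
        exact (mul_le_mul_of_nonneg_left this hδ.le).trans (hcon j (hn1.trans hj')).le
    rw [nsmul_eq_mul, Nat.card_Ico, show 2 * n - n = n by omega] at this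
    exact this
  have hnk : (k : ℝ) + 1 ≤ n := by exact_mod_cast hn3
  have hn0 : (0 : ℝ) < n := by linarith [Nat.cast_nonneg (α := ℝ) k]
  push_cast at h1
  have h4 : n * (δ * n) ≤ n * (2 * C * T) := by linarith
  have h5 := le_of_mul_le_mul_left h4 hn0
  nlinarith

theorem sum_ofReal_div_eq {a : ℕ → ℝ} (ha : ∀ n, 0 ≤ a n) {N : ℕ} (hN : 0 < N) :
    (∑ n ∈ Finset.range N, ENNReal.ofReal (a n)) / (N : ℝ≥0∞) =
      ENNReal.ofReal ((∑ n ∈ Finset.range N, a n) / N) := by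
  rw [← ENNReal.ofReal_sum_of_nonneg fun n _ => ha n,
    ENNReal.ofReal_div_of_pos (by exact_mod_cast hN), ENNReal.ofReal_natCast]

namespace System

variable {M L : ℕ} (S : System M L)

/-- The expectation, over the channels, of the largest total weight. -/
noncomputable def meanMaxValue (V : ℝ) (q : Fin M → ℝ) : ℝ :=
  ∫ r, S.maxValue V q r ∂(Measure.pi S.channelLaw)

theorem maxValue_nonneg (V : ℝ) (q r : Fin M → ℝ) : 0 ≤ S.maxValue V q r := by
  refine le_trans (le_of_eq ?_) (S.admissible_none.value_le_maxValue V q r)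
  simp [value, sessions]

theorem maxValue_le (V : ℝ) (q r : Fin M → ℝ) :
    S.maxValue V q r ≤ ∑ m, S.T * |S.weight V (q m) (r m)| := by
  refine Finset.sup'_le _ _ fun d _ => Finset.sum_le_sum fun m _ => ?_
  exact (mul_le_mul_of_nonneg_left (le_abs_self _) (by positivity)).trans
    (mul_le_mul_of_nonneg_right (by exact_mod_cast S.sessions_le _) (abs_nonneg _))

theorem measurable_maxValue (V : ℝ) :
    Measurable fun z : (Fin M → ℝ) × (Fin M → ℝ) => S.maxValue V z.1 z.2 := by
  classical
  have hne : (Finset.univ.filter S.Admissible).Nonempty :=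
    ⟨fun _ => none, by simp [S.admissible_none]⟩
  have : (fun z : (Fin M → ℝ) × (Fin M → ℝ) => S.maxValue V z.1 z.2) =
      (Finset.univ.filter S.Admissible).sup' hne (fun d z => S.value V z.1 z.2 d) := by
    funext z
    rw [Finset.sup'_apply, maxValue]
  rw [this]
  refine Finset.measurable_sup' _ fun d _ => ?_
  unfold value weight
  fun_prop

variable {S} {Ω : Type u} {mΩ : MeasurableSpace Ω} {μ : Measure Ω} {A R : Fin M → ℕ → Ω → ℝ}
  {D : ℕ → Ω → Decision M L} {α : Fin M → Measure ℝ}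

namespace IsNetwork

theorem measurable_R_vec (h : S.IsNetwork α μ A R) (n : ℕ) : Measurable fun ω m => R m n ω :=
  measurable_pi_lambda _ fun m => h.measurable_R m n

/-- Neither the epoch, the probability space nor the arrival law enters the right-hand side, so
algorithms on different spaces become comparable. -/
theorem integral_maxValue (h : S.IsNetwork α μ A R) (V : ℝ) (q : Fin M → ℝ) (n : ℕ) :
    ∫ ω, S.maxValue V q (fun m => R m n ω) ∂μ = S.meanMaxValue V q := by
  rw [meanMaxValue, ← h.map_R n]
  refine (integral_map (h.measurable_R_vec n).aemeasurable ?_).symm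
  exact ((S.measurable_maxValue V).comp measurable_prodMk_left).aestronglyMeasurable

theorem integrable_maxValue (h : S.IsNetwork α μ A R) {Rmax : ℝ} (hR : ∀ r ∈ S.rates, r ≤ Rmax)
    (V : ℝ) (q : Fin M → ℝ) (n : ℕ) :
    Integrable (fun ω => S.maxValue V q (fun m => R m n ω)) μ := by
  have := h.prob
  refine Integrable.of_bound
    (C := ∑ m, S.T * (|q m| * Rmax + |V * (S.Es - S.Esleep)|))
    ((S.measurable_maxValue V).comp
      (measurable_const.prodMk (h.measurable_R_vec n))).aestronglyMeasurable ?_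
  filter_upwards [h.ae_R] with ω hω
  rw [Real.norm_of_nonneg (S.maxValue_nonneg _ _ _)]
  refine (S.maxValue_le _ _ _).trans (Finset.sum_le_sum fun m _ => ?_)
  refine mul_le_mul_of_nonneg_left ((abs_sub _ _).trans (add_le_add_left ?_ _)) (by positivity)
  rw [abs_mul, abs_of_nonneg (S.rates_nonneg _ (hω m n))]
  exact mul_le_mul_of_nonneg_left (hR _ (hω m n)) (abs_nonneg _)

/-- No admissible decision rule has a larger expected total weight than the maximizing one. -/
theorem integral_service_le (h : S.IsNetwork α μ A R) (hD : S.IsCausal μ A R D)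
    (hadm : ∀ n ω, S.Admissible (D n ω)) {Rmax : ℝ} (hR : ∀ r ∈ S.rates, r ≤ Rmax)
    (V : ℝ) (q : Fin M → ℝ) (n : ℕ) :
    ∑ m, q m * ∫ ω, (S.sessions (D n ω m) : ℝ) * R m n ω ∂μ
      - V * (S.Es - S.Esleep) * ∑ m, ∫ ω, (S.sessions (D n ω m) : ℝ) ∂μ ≤ S.meanMaxValue V q := by
  have e : ∀ ω, S.value V q (fun m => R m n ω) (D n ω) =
      ∑ m, (q m * ((S.sessions (D n ω m) : ℝ) * R m n ω)
        - V * (S.Es - S.Esleep) * (S.sessions (D n ω m) : ℝ)) := fun ω => by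
    refine Finset.sum_congr rfl fun m _ => ?_
    unfold weight
    ring
  have hi : ∀ m, Integrable (fun ω => q m * ((S.sessions (D n ω m) : ℝ) * R m n ω)
        - V * (S.Es - S.Esleep) * (S.sessions (D n ω m) : ℝ)) μ := fun m =>
    ((h.integrable_service hD hR n m).const_mul _).sub ((h.integrable_sessions hD n m).const_mul _)
  rw [← h.integral_maxValue V q n]
  -- The comparison is pointwise in `ω`, so the dependence between decision and rates plays no role.
  have h1 := integral_mono (f := fun ω => S.value V q (fun m => R m n ω) (D n ω)) (by
    simp only [e]
    exact integrable_finsetSum _ fun m _ => hi m) (h.integrable_maxValue hR V q n)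
    fun ω => (hadm n ω).value_le_maxValue V q _
  refine le_trans (le_of_eq ?_) h1
  simp only [e]
  rw [integral_finsetSum _ fun m _ => hi m, Finset.mul_sum, ← Finset.sum_sub_distrib]
  refine Finset.sum_congr rfl fun m _ => ?_
  rw [integral_sub ((h.integrable_service hD hR n m).const_mul _)
    ((h.integrable_sessions hD n m).const_mul _), integral_const_mul, integral_const_mul]

/-- Data that arrived and was not offered service is still queued. A small mean queue therefore
forces the average service close to the arrival rate. -/
theorem le_integral_Q (h : S.IsNetwork α μ A R) (hD : S.IsCausal μ A R D)
    {Rmax : ℝ} (hR : ∀ r ∈ S.rates, r ≤ Rmax) (hα : ∀ m, Integrable id (α m)) (n : ℕ) (m : Fin M) :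
    n * (S.T * ∫ x, x ∂(α m))
        - ∑ k ∈ Finset.range n, ∫ ω, (S.sessions (D k ω m) : ℝ) * R m k ω ∂μ
      ≤ ∫ ω, S.Q A R D (n * S.T) m ω ∂μ := by
  have := h.prob
  induction n with
  | zero => simpa [Q, queue] using S.q0_nonneg m
  | succ n ih =>
    have hQ := h.integrable_Q hD hR hα
    have hA : ∀ τ ∈ Finset.Ico (n * S.T) (n * S.T + S.T), Integrable (A m τ) μ :=
      fun τ _ => h.integrable_A (hα m) τ
    have h1 := integral_mono (((hQ (n * S.T) m).sub (h.integrable_service hD hR n m)).add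
      (integrable_finsetSum _ hA)) (hQ ((n + 1) * S.T) m)
      fun ω => S.le_queue_epoch (fun m τ => A m τ ω) (fun m n => R m n ω) (fun n => D n ω) n m
    rw [integral_add' ((hQ (n * S.T) m).sub (h.integrable_service hD hR n m))
      (integrable_finsetSum _ hA), integral_sub' (hQ (n * S.T) m) (h.integrable_service hD hR n m),
      integral_finsetSum _ hA] at h1
    simp only [h.integral_A, Finset.sum_const, Nat.card_Ico, add_tsub_cancel_left,
      nsmul_eq_mul] at h1
    rw [Finset.sum_range_succ]
    push_cast
    linarith

/-- The expected energy consumption in an epoch. -/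
theorem sum_lintegral_epochEnergy (h : S.IsNetwork α μ A R) (hD : S.IsCausal μ A R D) (n : ℕ) :
    ∑ m, ∫⁻ ω, ENNReal.ofReal (S.epochEnergy (D n ω m)) ∂μ =
      ENNReal.ofReal (M * S.T * S.Esleep
        + (S.Es - S.Esleep) * ∑ m, ∫ ω, (S.sessions (D n ω m) : ℝ) ∂μ) := by
  have := h.prob
  have hi : ∀ m, Integrable (fun ω => S.epochEnergy (D n ω m)) μ := fun m => by
    simp only [epochEnergy_eq]
    exact (integrable_const _).add ((h.integrable_sessions hD n m).mul_const _)
  have e : ∀ m, ∫⁻ ω, ENNReal.ofReal (S.epochEnergy (D n ω m)) ∂μ =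
      ENNReal.ofReal (∫ ω, S.epochEnergy (D n ω m) ∂μ) := fun m =>
    (ofReal_integral_eq_lintegral_ofReal (hi m) (ae_of_all _ fun ω => S.epochEnergy_nonneg _)).symm
  simp only [e]
  rw [← ENNReal.ofReal_sum_of_nonneg fun m _ => integral_nonneg fun ω => S.epochEnergy_nonneg _]
  congr 1
  simp only [epochEnergy_eq]
  rw [Finset.mul_sum]
  have e2 : ∀ m, ∫ ω, ((S.T : ℝ) * S.Esleep + S.sessions (D n ω m) * (S.Es - S.Esleep)) ∂μ =
      S.T * S.Esleep + (S.Es - S.Esleep) * ∫ ω, (S.sessions (D n ω m) : ℝ) ∂μ := fun m => by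
    rw [integral_add (integrable_const _) ((h.integrable_sessions hD n m).mul_const _),
      integral_const, integral_mul_const, mul_comm (S.Es - S.Esleep)]
    simp
  simp only [e2, Finset.sum_add_distrib, Finset.sum_const, Finset.card_univ, Fintype.card_fin,
    nsmul_eq_mul]
  ring

theorem integral_sessions_nonneg (n : ℕ) (m : Fin M) :
    0 ≤ ∫ ω, (S.sessions (D n ω m) : ℝ) ∂μ :=
  integral_nonneg fun _ => Nat.cast_nonneg _

theorem expected_energy_nonneg (n : ℕ) : 0 ≤ M * S.T * S.Esleep
    + (S.Es - S.Esleep) * ∑ m, ∫ ω, (S.sessions (D n ω m) : ℝ) ∂μ := by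
  have h1 := S.Esleep_nonneg
  have h2 := sub_nonneg.2 S.Esleep_le_Es
  have h3 : 0 ≤ ∑ m, ∫ ω, (S.sessions (D n ω m) : ℝ) ∂μ :=
    Finset.sum_nonneg fun m _ => integral_sessions_nonneg n m
  positivity

theorem integral_sessions_le (h : S.IsNetwork α μ A R) (hD : S.IsCausal μ A R D) (n : ℕ)
    (m : Fin M) : ∫ ω, (S.sessions (D n ω m) : ℝ) ∂μ ≤ S.T := by
  have := h.prob
  have := integral_mono (h.integrable_sessions hD n m) (integrable_const (S.T : ℝ))
    fun ω => Nat.cast_le.2 (S.sessions_le (D n ω m))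
  simpa using this

/-- A stable queue process has, summed over the stations, time averages that stay bounded. -/
theorem exists_sum_integral_Q_le (h : S.IsNetwork α μ A R) (hF : S.IsFeasible μ A R D)
    {Rmax : ℝ} (hR : ∀ r ∈ S.rates, r ≤ Rmax) (hα : ∀ m, Integrable id (α m))
    (hα0 : ∀ m, ∀ᵐ x ∂(α m), 0 ≤ x) :
    ∃ C : ℝ, ∀ᶠ N : ℕ in atTop,
      ∑ τ ∈ Finset.range N, ∑ m, ∫ ω, S.Q A R D τ m ω ∂μ ≤ C * N := by
  have hm : ∀ m, ∃ C : ℝ, ∀ᶠ N : ℕ in atTop,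
      ∑ τ ∈ Finset.range N, ∫ ω, S.Q A R D τ m ω ∂μ ≤ C * N := by
    intro m
    obtain ⟨C, hC1, hC2⟩ := ENNReal.lt_iff_exists_nnreal_btwn.1 (hF.2.2 m)
    refine ⟨C, ?_⟩
    filter_upwards [eventually_lt_of_limsup_lt hC1, eventually_gt_atTop 0] with N hN hN0
    have e : ∀ τ, ∫⁻ ω, ENNReal.ofReal (S.Q A R D τ m ω) ∂μ =
        ENNReal.ofReal (∫ ω, S.Q A R D τ m ω ∂μ) := fun τ =>
      (ofReal_integral_eq_lintegral_ofReal (h.integrable_Q hF.1 hR hα τ m)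
        ((h.ae_Q_nonneg hα0).mono fun ω hω => hω τ m)).symm
    simp only [e] at hN
    rw [sum_ofReal_div_eq (fun τ => integral_nonneg_of_ae
      ((h.ae_Q_nonneg hα0).mono fun ω hω => hω τ m)) hN0, ← ENNReal.ofReal_coe_nnreal] at hN
    have := (ENNReal.ofReal_lt_ofReal_iff').1 hN
    rw [div_lt_iff₀ (by exact_mod_cast hN0)] at this
    exact this.1.le
  choose C hC using hm
  refine ⟨∑ m, C m, ?_⟩
  filter_upwards [eventually_all.2 hC] with N hN
  rw [Finset.sum_comm, Finset.sum_mul]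
  exact Finset.sum_le_sum fun m _ => hN m

/-- From any stabilizing algorithm one gets averages of the service and of the number of sessions
that are no better than maximal weight decisions, almost support the arrivals, and cost hardly more
energy. -/
theorem exists_average_service (h : S.IsNetwork α μ A R) (hF : S.IsFeasible μ A R D)
    {Rmax : ℝ} (hR : ∀ r ∈ S.rates, r ≤ Rmax) (hα : ∀ m, Integrable id (α m))
    (hα0 : ∀ m, ∀ᵐ x ∂(α m), 0 ≤ x) {δ : ℝ} (hδ : 0 < δ) :
    ∃ (s : Fin M → ℝ) (ν : ℝ),
      (∀ (V : ℝ) (q : Fin M → ℝ),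
        ∑ m, q m * s m - V * (S.Es - S.Esleep) * ν ≤ S.meanMaxValue V q) ∧
      (∀ m, S.T * ∫ x, x ∂(α m) - δ ≤ s m) ∧ ν ≤ M * S.T ∧
      ENNReal.ofReal (M * S.T * S.Esleep + (S.Es - S.Esleep) * ν)
        ≤ S.avgEnergy μ D + ENNReal.ofReal δ := by
  have hD := hF.1
  have hQ0 : ∀ τ m, 0 ≤ ∫ ω, S.Q A R D τ m ω ∂μ := fun τ m =>
    integral_nonneg_of_ae ((h.ae_Q_nonneg hα0).mono fun ω hω => hω τ m)
  have hE : ∀ᶠ N : ℕ in atTop, (∑ n ∈ Finset.range N, ∑ m,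
      ∫⁻ ω, ENNReal.ofReal (S.epochEnergy (D n ω m)) ∂μ) / (N : ℝ≥0∞)
        ≤ S.avgEnergy μ D + ENNReal.ofReal δ := by
    rcases eq_or_ne (S.avgEnergy μ D) ⊤ with htop | htop
    · simp [htop]
    · exact (eventually_lt_of_limsup_lt (ENNReal.lt_add_right htop
        (by simpa using hδ))).mono fun N hN => hN.le
  obtain ⟨C, hC⟩ := h.exists_sum_integral_Q_le hF hR hα hα0
  -- The energy bound holds for all large horizons, the queue bound only at arbitrarily large ones;
  -- a single `n` must satisfy both.
  obtain ⟨n₀, hn₀⟩ := eventually_atTop.1 (hE.and (eventually_gt_atTop 0))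
  obtain ⟨n, hn, hQn⟩ := exists_ge_le_mul_of_average_le
    (fun τ => Finset.sum_nonneg fun m _ => hQ0 τ m) hC S.T_pos hδ n₀
  obtain ⟨hEn, hn0⟩ := hn₀ n hn
  have hn0' : (0 : ℝ) < n := by exact_mod_cast hn0
  refine ⟨fun m => (∑ k ∈ Finset.range n, ∫ ω, (S.sessions (D k ω m) : ℝ) * R m k ω ∂μ) / n,
    (∑ k ∈ Finset.range n, ∑ m, ∫ ω, (S.sessions (D k ω m) : ℝ) ∂μ) / n, ?_, ?_, ?_, ?_⟩
  · intro V q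
    -- The inequality is linear in service and session count, with the same right-hand side in every
    -- epoch, so it passes to the averages.
    have h1 := Finset.sum_le_card_nsmul (Finset.range n) _ _
      fun k _ => h.integral_service_le hD hF.2.1 hR V q k
    rw [Finset.card_range, nsmul_eq_mul, Finset.sum_sub_distrib, Finset.sum_comm,
      ← Finset.mul_sum] at h1
    simp only [← Finset.mul_sum] at h1
    rw [← mul_le_mul_iff_right₀ hn0', mul_sub, Finset.mul_sum]
    refine le_trans (le_of_eq ?_) h1
    congr 1
    · refine Finset.sum_congr rfl fun m _ => ?_
      field_simp
    · field_simp
  · intro m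
    have h1 := h.le_integral_Q hD hR hα n m
    have h2 : ∫ ω, S.Q A R D (n * S.T) m ω ∂μ ≤ δ * n :=
      (Finset.single_le_sum (f := fun m => ∫ ω, S.Q A R D (n * S.T) m ω ∂μ)
        (fun m _ => hQ0 _ m) (Finset.mem_univ m)).trans hQn
    rw [le_div_iff₀ hn0']
    linarith
  · rw [div_le_iff₀ hn0']
    have h1 := Finset.sum_le_card_nsmul (Finset.range n) _ _ fun k _ =>
      Finset.sum_le_card_nsmul Finset.univ _ _ fun m _ => h.integral_sessions_le hD k m
    simp only [Finset.card_range, Finset.card_univ, Fintype.card_fin, nsmul_eq_mul] at h1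
    linarith
  · simp only [h.sum_lintegral_epochEnergy hD] at hEn
    rw [sum_ofReal_div_eq _ hn0] at hEn
    · convert hEn using 2
      rw [Finset.sum_add_distrib, Finset.sum_const, Finset.card_range, nsmul_eq_mul,
        ← Finset.mul_sum, add_div, mul_div_cancel_left₀ _ hn0'.ne', mul_div_assoc]
    · exact fun k => expected_energy_nonneg k

end IsNetwork

end System

/-! ### Telescoping, and the expected drift under JTWSA. -/

theorem sum_range_le_of_telescoping {l a c : ℕ → ℝ} (hl : ∀ n, 0 ≤ l n)
    (h : ∀ n, l (n + 1) + a n ≤ l n + c n) (N : ℕ) :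
    ∑ n ∈ Finset.range N, a n ≤ ∑ n ∈ Finset.range N, c n + l 0 := by
  have : ∑ n ∈ Finset.range N, a n + l N ≤ ∑ n ∈ Finset.range N, c n + l 0 := by
    induction N with
    | zero => simp
    | succ N ih =>
      rw [Finset.sum_range_succ, Finset.sum_range_succ]
      linarith [h N]
  linarith [hl N]

theorem limsup_average_le {a : ℕ → ℝ} (ha : ∀ n, 0 ≤ a n) {c C : ℝ}
    (h : ∀ N : ℕ, ∑ n ∈ Finset.range N, a n ≤ N * c + C) :
    limsup (fun N : ℕ => (∑ n ∈ Finset.range N, ENNReal.ofReal (a n)) / (N : ℝ≥0∞)) atTop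
      ≤ ENNReal.ofReal c := by
  have ht : Tendsto (fun N : ℕ => ENNReal.ofReal (c + C / N)) atTop (nhds (ENNReal.ofReal c)) := by
    refine ENNReal.tendsto_ofReal ?_
    simpa using (tendsto_const_nhds (x := c)).add (tendsto_const_div_atTop_nhds_zero_nat C)
  rw [← ht.limsup_eq]
  refine limsup_le_limsup ?_
  filter_upwards [eventually_gt_atTop 0] with N hN
  rw [sum_ofReal_div_eq ha hN]
  refine ENNReal.ofReal_le_ofReal ?_
  have hN' : (0 : ℝ) < N := by exact_mod_cast hN
  rw [div_le_iff₀ hN', add_mul, div_mul_cancel₀ _ hN'.ne']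
  linarith [h N]

theorem sum_range_mul_div (f : ℕ → ℝ) {T : ℕ} (hT : 0 < T) (N : ℕ) :
    ∑ τ ∈ Finset.range (N * T), f (τ / T) = T * ∑ n ∈ Finset.range N, f n := by
  induction N with
  | zero => simp
  | succ N ih =>
    rw [add_one_mul, Finset.sum_range_add, ih, Finset.sum_range_succ, mul_add]
    congr 1
    rw [Finset.sum_congr rfl (g := fun _ => f N), Finset.sum_const, Finset.card_range, nsmul_eq_mul]
    intro i hi
    rw [add_comm, Nat.add_mul_div_right _ _ hT, Nat.div_eq_of_lt (Finset.mem_range.1 hi), zero_add]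

namespace System

variable {M L : ℕ} {S : System M L} {Ω : Type u} {mΩ : MeasurableSpace Ω} {μ : Measure Ω}
  {A R : Fin M → ℕ → Ω → ℝ} {D : ℕ → Ω → Decision M L} {α : Fin M → Measure ℝ}

theorem sum_epochEnergy (d : Decision M L) : ∑ m, S.epochEnergy (d m) =
    M * S.T * S.Esleep + (S.Es - S.Esleep) * ∑ m, (S.sessions (d m) : ℝ) := by
  simp only [epochEnergy_eq, Finset.sum_add_distrib, Finset.sum_const, Finset.card_univ,
    Fintype.card_fin, nsmul_eq_mul, ← Finset.sum_mul]
  ring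

namespace IsNetwork

theorem integrable_arrival (h : S.IsNetwork α μ A R) {Amax : ℝ}
    (hA : ∀ m, ∀ᵐ x ∂(α m), 0 ≤ x ∧ x ≤ Amax) (m : Fin M) : Integrable id (α m) := by
  have := h.prob
  have : IsProbabilityMeasure (α m) := by
    rw [← h.law_A m 0]
    exact Measure.isProbabilityMeasure_map (h.measurable_A m 0).aemeasurable
  refine Integrable.of_bound (C := Amax) aestronglyMeasurable_id ?_
  filter_upwards [hA m] with x hx
  rw [id, Real.norm_of_nonneg hx.1]
  exact hx.2

theorem ae_Q_add_le (h : S.IsNetwork α μ A R) {Amax : ℝ}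
    (hA : ∀ m, ∀ᵐ x ∂(α m), 0 ≤ x ∧ x ≤ Amax) :
    ∀ᵐ ω ∂μ, ∀ t k m, S.Q A R D (t + k) m ω ≤ S.Q A R D t m ω + k * Amax := by
  filter_upwards [h.ae_A hA, h.ae_R] with ω hω hr t k m
  exact S.queue_add_le _ (fun m τ => (hω m τ).1) (fun m τ => (hω m τ).2)
    (fun m n => S.rates_nonneg _ (hr m n)) t k m

/-- At a fixed time the queue is essentially bounded, which settles the integrability of its square
and of its products with service and arrivals. -/
theorem ae_norm_Q_le (h : S.IsNetwork α μ A R) {Amax : ℝ}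
    (hA : ∀ m, ∀ᵐ x ∂(α m), 0 ≤ x ∧ x ≤ Amax) (τ : ℕ) (m : Fin M) :
    ∀ᵐ ω ∂μ, ‖S.Q A R D τ m ω‖ ≤ S.q0 m + τ * Amax := by
  filter_upwards [h.ae_Q_add_le (D := D) hA,
    h.ae_Q_nonneg (D := D) fun m => (hA m).mono fun x hx => hx.1] with ω h1 h2
  rw [Real.norm_of_nonneg (h2 τ m)]
  have := h1 0 τ m
  rwa [zero_add] at this

theorem integrable_mul_Q (h : S.IsNetwork α μ A R) (hD : S.IsCausal μ A R D) {Amax : ℝ}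
    (hA : ∀ m, ∀ᵐ x ∂(α m), 0 ≤ x ∧ x ≤ Amax) (τ : ℕ) (m : Fin M) {f : Ω → ℝ}
    (hf : Integrable f μ) : Integrable (fun ω => S.Q A R D τ m ω * f ω) μ :=
  hf.bdd_mul (h.measurable_Q hD τ m).aestronglyMeasurable (h.ae_norm_Q_le hA τ m)

theorem integrable_value (h : S.IsNetwork α μ A R) (hD : S.IsCausal μ A R D) {Rmax Amax : ℝ}
    (hR : ∀ r ∈ S.rates, r ≤ Rmax) (hA : ∀ m, ∀ᵐ x ∂(α m), 0 ≤ x ∧ x ≤ Amax) (V : ℝ) (n : ℕ) :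
    Integrable (fun ω => S.value V (fun m => S.Q A R D (n * S.T) m ω) (fun m => R m n ω) (D n ω))
      μ := by
  have e : ∀ ω, S.value V (fun m => S.Q A R D (n * S.T) m ω) (fun m => R m n ω) (D n ω) =
      ∑ m, (S.Q A R D (n * S.T) m ω * ((S.sessions (D n ω m) : ℝ) * R m n ω)
        - V * (S.Es - S.Esleep) * (S.sessions (D n ω m) : ℝ)) := fun ω => by
    refine Finset.sum_congr rfl fun m _ => ?_
    unfold weight
    ring
  simp only [e]
  exact integrable_finsetSum _ fun m _ =>
    (h.integrable_mul_Q hD hA _ m (h.integrable_service hD hR n m)).sub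
      ((h.integrable_sessions hD n m).const_mul _)

/-- JTWSA is, on average, no worse than deciding on the basis of the queue lengths only. -/
theorem le_integral_value_of_isJTWSA (h : S.IsNetwork α μ A R) (hD : S.IsCausal μ A R D)
    {Rmax Amax V : ℝ} (hR : ∀ r ∈ S.rates, r ≤ Rmax) (hA : ∀ m, ∀ᵐ x ∂(α m), 0 ≤ x ∧ x ≤ Amax)
    {n : ℕ} (hJ : ∀ ω, S.IsJTWSA V (fun m => S.Q A R D (n * S.T) m ω) (fun m => R m n ω) (D n ω))
    {s : Fin M → ℝ} {c : ℝ} (hs : ∀ q, ∑ m, q m * s m - c ≤ S.meanMaxValue V q) :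
    ∑ m, (∫ ω, S.Q A R D (n * S.T) m ω ∂μ) * s m - c ≤
      ∫ ω, S.value V (fun m => S.Q A R D (n * S.T) m ω) (fun m => R m n ω) (D n ω) ∂μ := by
  have := h.prob
  have hQm : Measurable fun ω m => S.Q A R D (n * S.T) m ω :=
    measurable_pi_lambda _ fun m => h.measurable_Q hD _ m
  have hRm := h.measurable_R_vec n
  have hG := S.measurable_maxValue V
  have hmap : μ.map (fun ω => ((fun m => S.Q A R D (n * S.T) m ω), fun m => R m n ω)) =
      (μ.map fun ω m => S.Q A R D (n * S.T) m ω).prod (Measure.pi S.channelLaw) := by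
    rw [← h.map_R n]
    exact (indepFun_iff_map_prod_eq_prod_map_map hQm.aemeasurable hRm.aemeasurable).1
      (h.indepFun_Q_R hD n)
  have hint := h.integrable_value hD hR hA V n
  simp only [fun ω => (hJ ω).value_eq_maxValue] at hint ⊢
  have hint' : Integrable (fun z : (Fin M → ℝ) × (Fin M → ℝ) => S.maxValue V z.1 z.2)
      ((μ.map fun ω m => S.Q A R D (n * S.T) m ω).prod (Measure.pi S.channelLaw)) := by
    rw [← hmap]
    exact (integrable_map_measure hG.aestronglyMeasurable (hQm.prodMk hRm).aemeasurable).2 hint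
  have hprob : IsProbabilityMeasure (μ.map fun ω m => S.Q A R D (n * S.T) m ω) :=
    Measure.isProbabilityMeasure_map hQm.aemeasurable
  have hpi : IsProbabilityMeasure (Measure.pi S.channelLaw) := by
    rw [← h.map_R n]
    exact Measure.isProbabilityMeasure_map hRm.aemeasurable
  -- The joint law of queues and rates is a product, so Fubini integrates out the rates first; `hs`
  -- then applies at the random queue vector.
  have e1 : ∫ ω, S.maxValue V (fun m => S.Q A R D (n * S.T) m ω) (fun m => R m n ω) ∂μ =
      ∫ q, S.meanMaxValue V q ∂(μ.map fun ω m => S.Q A R D (n * S.T) m ω) := by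
    rw [← integral_map (hQm.prodMk hRm).aemeasurable
      (f := fun z : (Fin M → ℝ) × (Fin M → ℝ) => S.maxValue V z.1 z.2) hG.aestronglyMeasurable,
      hmap, integral_prod _ hint']
    rfl
  have hW : Integrable (S.meanMaxValue V) (μ.map fun ω m => S.Q A R D (n * S.T) m ω) :=
    hint'.integral_prod_left
  have e2 := integral_map hQm.aemeasurable hW.aestronglyMeasurable
  rw [e1, e2]
  have hQi := fun m => h.integrable_Q hD hR (h.integrable_arrival hA) (n * S.T) m
  have hi : ∀ m ∈ Finset.univ, Integrable (fun ω => S.Q A R D (n * S.T) m ω * s m) μ :=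
    fun m _ => (hQi m).mul_const _
  have e3 : ∑ m, (∫ ω, S.Q A R D (n * S.T) m ω ∂μ) * s m - c =
      ∫ ω, (∑ m, S.Q A R D (n * S.T) m ω * s m - c) ∂μ := by
    rw [integral_sub (integrable_finsetSum _ hi) (integrable_const _), integral_finsetSum _ hi]
    simp [integral_mul_const]
  rw [e3]
  exact integral_mono ((integrable_finsetSum _ hi).sub (integrable_const _))
    ((integrable_map_measure hW.aestronglyMeasurable hQm.aemeasurable).1 hW) fun ω => hs _

/-- The expected drift of the quadratic Lyapunov function under JTWSA. -/
theorem expected_drift_le (h : S.IsNetwork α μ A R) (hD : S.IsCausal μ A R D)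
    {Rmax Amax V : ℝ} (hR : ∀ r ∈ S.rates, r ≤ Rmax) (hA : ∀ m, ∀ᵐ x ∂(α m), 0 ≤ x ∧ x ≤ Amax)
    {n : ℕ} (hJ : ∀ ω, S.IsJTWSA V (fun m => S.Q A R D (n * S.T) m ω) (fun m => R m n ω) (D n ω))
    {s : Fin M → ℝ} {ν : ℝ}
    (hs : ∀ q, ∑ m, q m * s m - V * (S.Es - S.Esleep) * ν ≤ S.meanMaxValue V q) :
    ∑ m, ∫ ω, S.Q A R D ((n + 1) * S.T) m ω ^ 2 / 2 ∂μ
        + V * (M * S.T * S.Esleep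
          + (S.Es - S.Esleep) * ∑ m, ∫ ω, (S.sessions (D n ω m) : ℝ) ∂μ) ≤
      ∑ m, ∫ ω, S.Q A R D (n * S.T) m ω ^ 2 / 2 ∂μ
        + M * S.T ^ 2 * (Rmax ^ 2 + Amax ^ 2) / 2
        + ∑ m, (∫ ω, S.Q A R D (n * S.T) m ω ∂μ) * (S.T * ∫ x, x ∂(α m) - s m)
        + V * (M * S.T * S.Esleep + (S.Es - S.Esleep) * ν) := by
  have := h.prob
  have hval := h.le_integral_value_of_isJTWSA hD hR hA hJ hs
  have hvi := h.integrable_value hD hR hA V n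
  have hα := h.integrable_arrival hA
  have hQi := fun τ m => h.integrable_Q hD hR hα τ m
  have hQ2 : ∀ τ, ∀ m ∈ Finset.univ, Integrable (fun ω => S.Q A R D τ m ω ^ 2 / 2) μ :=
    fun τ m _ => by
      have := (h.integrable_mul_Q hD hA τ m (hQi τ m)).div_const 2
      simpa only [pow_two] using this
  have hQA : ∀ m, ∀ τ ∈ Finset.Ico (n * S.T) (n * S.T + S.T),
      Integrable (fun ω => S.Q A R D (n * S.T) m ω * A m τ ω) μ := fun m τ _ =>
    h.integrable_mul_Q hD hA _ m (h.integrable_A (hα m) τ)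
  have hQAs : ∀ m ∈ Finset.univ, Integrable (fun ω =>
      ∑ τ ∈ Finset.Ico (n * S.T) (n * S.T + S.T), S.Q A R D (n * S.T) m ω * A m τ ω) μ :=
    fun m _ => integrable_finsetSum _ (hQA m)
  have hN : ∀ m ∈ Finset.univ, Integrable (fun ω => (S.sessions (D n ω m) : ℝ)) μ :=
    fun m _ => h.integrable_sessions hD n m
  have hE : Integrable (fun ω => V * (M * S.T * S.Esleep
          + (S.Es - S.Esleep) * ∑ m, (S.sessions (D n ω m) : ℝ))) μ :=
    ((integrable_const _).add ((integrable_finsetSum _ hN).const_mul _)).const_mul _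
  have hL1 := integrable_finsetSum _ (hQ2 ((n + 1) * S.T))
  have hL0 := integrable_finsetSum _ (hQ2 (n * S.T))
  have hX := integrable_finsetSum _ hQAs
  have hB : Integrable (fun _ : Ω => M * S.T ^ 2 * (Rmax ^ 2 + Amax ^ 2) / 2) μ :=
    integrable_const _
  have hC : Integrable (fun _ : Ω => V * (M * S.T * S.Esleep)) μ := integrable_const _
  have key := integral_mono_ae (hL1.add hE) ((((hL0.add hB).add hX).add hC).sub hvi) (by
    filter_upwards [h.ae_A hA, h.ae_R] with ω ha hr
    have := S.drift_le (a := fun m τ => A m τ ω) (r := fun m n => R m n ω) (fun n => D n ω)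
      (V := V) (fun m τ => (ha m τ).1) (fun m τ => (ha m τ).2)
      (fun m n => S.rates_nonneg _ (hr m n)) (fun m n => hR _ (hr m n)) n
    simp only [sum_epochEnergy, Finset.mul_sum] at this
    simp only [Pi.add_apply, Pi.sub_apply, Finset.mul_sum]
    exact this)
  rw [integral_add' hL1 hE, integral_sub' (((hL0.add hB).add hX).add hC) hvi,
    integral_add' ((hL0.add hB).add hX) hC, integral_add' (hL0.add hB) hX, integral_add' hL0 hB,
    integral_finsetSum _ (hQ2 _), integral_finsetSum _ (hQ2 _), integral_finsetSum _ hQAs,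
    integral_const_mul, integral_add (integrable_const _) ((integrable_finsetSum _ hN).const_mul _),
    integral_const_mul (S.Es - S.Esleep), integral_finsetSum _ hN] at key
  simp only [integral_const, probReal_univ, one_smul] at key
  -- Arrivals during the epoch are independent of the queue at its start, so the expectation of each
  -- product factors.
  have e : ∀ m, ∫ ω, ∑ τ ∈ Finset.Ico (n * S.T) (n * S.T + S.T),
      S.Q A R D (n * S.T) m ω * A m τ ω ∂μ =
      (∫ ω, S.Q A R D (n * S.T) m ω ∂μ) * (S.T * ∫ x, x ∂(α m)) := fun m => by
    rw [integral_finsetSum _ (hQA m), Finset.sum_congr rfl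
      (g := fun _ => (∫ ω, S.Q A R D (n * S.T) m ω ∂μ) * ∫ x, x ∂(α m))]
    · rw [Finset.sum_const, Nat.card_Ico, nsmul_eq_mul]
      simp only [add_tsub_cancel_left]
      ring
    · intro τ hτ
      rw [← h.integral_A m τ]
      exact (h.indepFun_Q_A hD (Finset.mem_Ico.1 hτ).1 m).integral_fun_mul_eq_mul_integral
        (h.measurable_Q hD _ m).aestronglyMeasurable (h.measurable_A m τ).aestronglyMeasurable
  simp only [e] at key
  simp only [mul_sub, Finset.sum_sub_distrib]
  linarith

end IsNetwork

end System

/-! ### Stability, queue bound and energy bound for JTWSA. -/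

namespace System

variable {M L : ℕ} {S : System M L} {Ω : Type u} {mΩ : MeasurableSpace Ω} {μ : Measure Ω}
  {A R : Fin M → ℕ → Ω → ℝ} {D : ℕ → Ω → Decision M L} {α : Fin M → Measure ℝ}

namespace IsNetwork

theorem lintegral_Q (h : S.IsNetwork α μ A R) (hD : S.IsCausal μ A R D)
    {Rmax Amax : ℝ} (hR : ∀ r ∈ S.rates, r ≤ Rmax) (hA : ∀ m, ∀ᵐ x ∂(α m), 0 ≤ x ∧ x ≤ Amax)
    (τ : ℕ) (m : Fin M) : ∫⁻ ω, ENNReal.ofReal (S.Q A R D τ m ω) ∂μ =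
      ENNReal.ofReal (∫ ω, S.Q A R D τ m ω ∂μ) :=
  (ofReal_integral_eq_lintegral_ofReal (h.integrable_Q hD hR (h.integrable_arrival hA) τ m)
    ((h.ae_Q_nonneg fun m => (hA m).mono fun _ hx => hx.1).mono fun _ hω => hω τ m)).symm

theorem integral_Q_nonneg (h : S.IsNetwork α μ A R) {Amax : ℝ}
    (hA : ∀ m, ∀ᵐ x ∂(α m), 0 ≤ x ∧ x ≤ Amax) (τ : ℕ) (m : Fin M) :
    0 ≤ ∫ ω, S.Q A R D τ m ω ∂μ :=
  integral_nonneg_of_ae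
    ((h.ae_Q_nonneg fun m => (hA m).mono fun _ hx => hx.1).mono fun _ hω => hω τ m)

theorem avgQueue_le (h : S.IsNetwork α μ A R) (hD : S.IsCausal μ A R D)
    {Rmax Amax : ℝ} (hR : ∀ r ∈ S.rates, r ≤ Rmax) (hA : ∀ m, ∀ᵐ x ∂(α m), 0 ≤ x ∧ x ≤ Amax)
    {c C : ℝ} (hc : ∀ N : ℕ, ∑ n ∈ Finset.range N, ∑ m, ∫ ω, S.Q A R D (n * S.T) m ω ∂μ ≤
      N * c + C) : S.avgQueue μ A R D ≤ ENNReal.ofReal c := by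
  have h0 := fun τ m => h.integral_Q_nonneg (D := D) hA τ m
  unfold avgQueue
  simp only [h.lintegral_Q hD hR hA, ← ENNReal.ofReal_sum_of_nonneg fun m _ => h0 _ m]
  exact limsup_average_le (fun n => Finset.sum_nonneg fun m _ => h0 _ m) hc

theorem avgEnergy_le (h : S.IsNetwork α μ A R) (hD : S.IsCausal μ A R D)
    {c C : ℝ} (hc : ∀ N : ℕ, ∑ n ∈ Finset.range N, (M * S.T * S.Esleep
        + (S.Es - S.Esleep) * ∑ m, ∫ ω, (S.sessions (D n ω m) : ℝ) ∂μ) ≤ N * c + C) :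
    S.avgEnergy μ D ≤ ENNReal.ofReal c := by
  unfold avgEnergy
  simp only [h.sum_lintegral_epochEnergy hD]
  exact limsup_average_le (fun n => expected_energy_nonneg n) hc

theorem avgEnergy_lt_top (h : S.IsNetwork α μ A R) (hD : S.IsCausal μ A R D) :
    S.avgEnergy μ D < ⊤ := by
  refine (h.avgEnergy_le hD (c := M * S.T * S.Es) (C := 0) fun N => ?_).trans_lt
    ENNReal.ofReal_lt_top
  have := Finset.sum_le_card_nsmul (Finset.range N) (fun n => M * S.T * S.Esleep
    + (S.Es - S.Esleep) * ∑ m, ∫ ω, (S.sessions (D n ω m) : ℝ) ∂μ) (M * S.T * S.Es) fun n _ => by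
      have h1 := Finset.sum_le_card_nsmul Finset.univ _ _
        fun m _ => h.integral_sessions_le hD n m
      rw [Finset.card_univ, Fintype.card_fin, nsmul_eq_mul] at h1
      have := mul_le_mul_of_nonneg_left h1 (sub_nonneg.2 S.Esleep_le_Es)
      linarith
  simpa using this

/-- Bounded averages of the queues at the epoch boundaries imply stability. -/
theorem isStable_of_sum_le (h : S.IsNetwork α μ A R) (hD : S.IsCausal μ A R D)
    {Rmax Amax : ℝ} (hR : ∀ r ∈ S.rates, r ≤ Rmax) (hA : ∀ m, ∀ᵐ x ∂(α m), 0 ≤ x ∧ x ≤ Amax)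
    {c C : ℝ} (hc : ∀ N : ℕ, ∑ n ∈ Finset.range N, ∑ m, ∫ ω, S.Q A R D (n * S.T) m ω ∂μ ≤
      N * c + C) : S.IsStable μ A R D := by
  intro m
  have := h.prob
  have h0 := fun τ m => h.integral_Q_nonneg (D := D) hA τ m
  -- Within an epoch a queue grows by at most `T * |Amax|`; the absolute value spares a proof that
  -- `Amax` is nonnegative.
  have hstep : ∀ τ, ∫ ω, S.Q A R D τ m ω ∂μ ≤
      ∑ m, ∫ ω, S.Q A R D (τ / S.T * S.T) m ω ∂μ + S.T * |Amax| := by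
    intro τ
    refine le_trans ?_ (add_le_add_left (Finset.single_le_sum
      (f := fun m => ∫ ω, S.Q A R D (τ / S.T * S.T) m ω ∂μ) (fun m _ => h0 _ m)
      (Finset.mem_univ m)) _)
    have hQ := fun τ => h.integrable_Q hD hR (h.integrable_arrival hA) τ m
    have h1 := integral_mono_ae (hQ τ)
      ((hQ (τ / S.T * S.T)).add (integrable_const (S.T * |Amax|))) (by
        filter_upwards [h.ae_Q_add_le (D := D) hA] with ω hω
        have h2 := hω (τ / S.T * S.T) (τ % S.T) m
        rw [Nat.div_add_mod'] at h2
        refine h2.trans (add_le_add_right ?_ _)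
        refine (mul_le_mul_of_nonneg_left (le_abs_self Amax) (Nat.cast_nonneg _)).trans ?_
        exact mul_le_mul_of_nonneg_right (Nat.cast_le.2 (Nat.mod_lt _ S.T_pos).le) (abs_nonneg _))
    rw [integral_add' (hQ _) (integrable_const _)] at h1
    simpa using h1
  simp only [h.lintegral_Q hD hR hA]
  refine (limsup_average_le (fun τ => h0 τ m) (c := S.T * c + S.T * (S.T * |Amax|))
    (C := S.T * C) fun N => ?_).trans_lt ENNReal.ofReal_lt_top
  -- Extending `N` mini-slots to `N` whole epochs loses a factor that is harmless for finiteness.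
  calc ∑ τ ∈ Finset.range N, ∫ ω, S.Q A R D τ m ω ∂μ
      ≤ ∑ τ ∈ Finset.range (N * S.T), ∫ ω, S.Q A R D τ m ω ∂μ :=
        Finset.sum_le_sum_of_subset_of_nonneg
          (Finset.range_subset_range.2 (Nat.le_mul_of_pos_right _ S.T_pos)) fun τ _ _ => h0 τ m
    _ ≤ ∑ τ ∈ Finset.range (N * S.T),
          (∑ m, ∫ ω, S.Q A R D (τ / S.T * S.T) m ω ∂μ + S.T * |Amax|) :=
        Finset.sum_le_sum fun τ _ => hstep τ
    _ = S.T * ∑ n ∈ Finset.range N, ∑ m, ∫ ω, S.Q A R D (n * S.T) m ω ∂μ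
          + N * (S.T * (S.T * |Amax|)) := by
        rw [Finset.sum_add_distrib,
          sum_range_mul_div (fun n => ∑ m, ∫ ω, S.Q A R D (n * S.T) m ω ∂μ) S.T_pos]
        simp
        ring
    _ ≤ N * (S.T * c + S.T * (S.T * |Amax|)) + S.T * C := by
        have := mul_le_mul_of_nonneg_left (hc N) (Nat.cast_nonneg (α := ℝ) S.T)
        linarith

/-- Under JTWSA, when the mean arrivals can be increased by `ε` within the capacity region, the
queues at the epoch boundaries have bounded averages. -/
theorem sum_integral_Q_le_of_isJTWSA (h : S.IsNetwork α μ A R) (hD : S.IsCausal μ A R D)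
    {Rmax Amax V : ℝ} (hV : 0 ≤ V) (hR : ∀ r ∈ S.rates, r ≤ Rmax)
    (hA : ∀ m, ∀ᵐ x ∂(α m), 0 ≤ x ∧ x ≤ Amax)
    (hJ : ∀ n ω, S.IsJTWSA V (fun m => S.Q A R D (n * S.T) m ω) (fun m => R m n ω) (D n ω))
    {ε : ℝ} (hcap : (fun m => ∫ x, x ∂(α m) + ε) ∈ S.capacityRegion.{u}) {δ : ℝ} (hδ : 0 < δ)
    (hδε : δ < S.T * ε) :
    ∃ C : ℝ, ∀ N : ℕ, ∑ n ∈ Finset.range N, ∑ m, ∫ ω, S.Q A R D (n * S.T) m ω ∂μ ≤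
      N * ((M * S.T ^ 2 * (Rmax ^ 2 + Amax ^ 2) / 2 + V * (M * S.T * S.Es)) / (S.T * ε - δ))
        + C := by
  -- The competitor may face different arrival laws `α'`; only their means, larger by `ε`, are used.
  obtain ⟨α', hα', Ω', _, μ', A', R', D', h', hF'⟩ := hcap
  obtain ⟨s, ν, hs, hsm, hν, -⟩ := h'.exists_average_service hF' hR (fun m => (hα' m).2.1)
    (fun m => (hα' m).1) hδ
  have hpos : 0 < S.T * ε - δ := sub_pos.2 hδε
  refine ⟨(∑ m, ∫ ω, S.Q A R D (0 * S.T) m ω ^ 2 / 2 ∂μ) / (S.T * ε - δ), fun N => ?_⟩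
  have h0 := fun τ m => h.integral_Q_nonneg (D := D) hA τ m
  have := sum_range_le_of_telescoping
    (l := fun n => ∑ m, ∫ ω, S.Q A R D (n * S.T) m ω ^ 2 / 2 ∂μ)
    (a := fun n => (S.T * ε - δ) * ∑ m, ∫ ω, S.Q A R D (n * S.T) m ω ∂μ)
    (c := fun _ => M * S.T ^ 2 * (Rmax ^ 2 + Amax ^ 2) / 2 + V * (M * S.T * S.Es))
    (fun n => Finset.sum_nonneg fun m _ => integral_nonneg fun ω => by positivity)
    (fun n => by
      have hd := h.expected_drift_le hD hR hA (hJ n) (hs V)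
      have h1 : ∑ m, (∫ ω, S.Q A R D (n * S.T) m ω ∂μ) * (S.T * ∫ x, x ∂(α m) - s m) ≤
          -((S.T * ε - δ) * ∑ m, ∫ ω, S.Q A R D (n * S.T) m ω ∂μ) := by
        rw [Finset.mul_sum, ← Finset.sum_neg_distrib]
        refine Finset.sum_le_sum fun m _ => ?_
        have h2 := hsm m
        rw [(hα' m).2.2] at h2
        have h3 : S.T * ∫ x, x ∂(α m) - s m ≤ -(S.T * ε - δ) := by linarith
        exact (mul_le_mul_of_nonneg_left h3 (h0 _ m)).trans (le_of_eq (by ring))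
      -- The energy spent by JTWSA is dropped, and `ν ≤ M * T` bounds the competitor's energy by `M
      -- * T * Es`.
      have h4 := mul_nonneg hV (expected_energy_nonneg (S := S) (D := D) (μ := μ) n)
      have h5 := mul_le_mul_of_nonneg_left
        (mul_le_mul_of_nonneg_left hν (sub_nonneg.2 S.Esleep_le_Es)) hV
      linarith) N
  rw [← Finset.mul_sum, Finset.sum_const, Finset.card_range, nsmul_eq_mul] at this
  rw [← mul_div_assoc, ← add_div, le_div_iff₀ hpos]
  linarith

theorem isFeasible_of_isJTWSA (h : S.IsNetwork α μ A R) (hD : S.IsCausal μ A R D)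
    {Rmax Amax V : ℝ} (hV : 0 ≤ V) (hR : ∀ r ∈ S.rates, r ≤ Rmax)
    (hA : ∀ m, ∀ᵐ x ∂(α m), 0 ≤ x ∧ x ≤ Amax)
    (hJ : ∀ n ω, S.IsJTWSA V (fun m => S.Q A R D (n * S.T) m ω) (fun m => R m n ω) (D n ω))
    {ε : ℝ} (hε : 0 < ε) (hcap : (fun m => ∫ x, x ∂(α m) + ε) ∈ S.capacityRegion.{u}) :
    S.IsFeasible μ A R D := by
  have hT : (0 : ℝ) < S.T := by exact_mod_cast S.T_pos
  obtain ⟨C, hC⟩ := h.sum_integral_Q_le_of_isJTWSA hD hV hR hA hJ hcap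
    (half_pos (mul_pos hT hε)) (half_lt_self (mul_pos hT hε))
  exact ⟨hD, fun n ω => (hJ n ω).admissible, h.isStable_of_sum_le hD hR hA hC⟩

theorem avgQueue_le_of_isJTWSA (h : S.IsNetwork α μ A R) (hD : S.IsCausal μ A R D)
    {Rmax Amax V : ℝ} (hV : 0 ≤ V) (hR : ∀ r ∈ S.rates, r ≤ Rmax)
    (hA : ∀ m, ∀ᵐ x ∂(α m), 0 ≤ x ∧ x ≤ Amax)
    (hJ : ∀ n ω, S.IsJTWSA V (fun m => S.Q A R D (n * S.T) m ω) (fun m => R m n ω) (D n ω))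
    {ε : ℝ} (hε : 0 < ε) (hcap : (fun m => ∫ x, x ∂(α m) + ε) ∈ S.capacityRegion.{u}) :
    S.avgQueue μ A R D ≤ ENNReal.ofReal
      ((M * S.T ^ 2 * (Rmax ^ 2 + Amax ^ 2) / 2 + V * (M * S.T * S.Es)) / ε) := by
  have hT : (1 : ℝ) ≤ S.T := by exact_mod_cast S.T_pos
  have hTε : 0 < S.T * ε := by positivity
  set X : ℝ := M * S.T ^ 2 * (Rmax ^ 2 + Amax ^ 2) / 2 + V * (M * S.T * S.Es) with hX
  have hX0 : 0 ≤ X := by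
    have := S.Esleep_nonneg.trans S.Esleep_le_Es
    positivity
  have hlim : Tendsto (fun δ => ENNReal.ofReal (X / (S.T * ε - δ))) (nhdsWithin 0 (Set.Ioi 0))
      (nhds (ENNReal.ofReal (X / (S.T * ε - 0)))) := by
    refine ENNReal.tendsto_ofReal (Tendsto.mono_left ?_ nhdsWithin_le_nhds)
    exact tendsto_const_nhds.div (tendsto_const_nhds.sub tendsto_id) (by simpa using hTε.ne')
  -- Letting `δ → 0` gives the denominator `T * ε`, and `T ≥ 1` weakens it to `ε`.
  refine (ge_of_tendsto hlim ?_).trans (ENNReal.ofReal_le_ofReal ?_)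
  · filter_upwards [Ioo_mem_nhdsGT hTε] with δ hδ
    obtain ⟨C, hC⟩ := h.sum_integral_Q_le_of_isJTWSA hD hV hR hA hJ hcap hδ.1 hδ.2
    exact h.avgQueue_le hD hR hA hC
  · rw [sub_zero]
    exact div_le_div_of_nonneg_left hX0 hε (le_mul_of_one_le_left hε.le hT)

/-- JTWSA consumes at most `B / V` more energy than any stabilizing algorithm. -/
theorem avgEnergy_le_of_isJTWSA (h : S.IsNetwork α μ A R) (hD : S.IsCausal μ A R D)
    {Rmax Amax V : ℝ} (hV : 0 < V) (hR : ∀ r ∈ S.rates, r ≤ Rmax)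
    (hA : ∀ m, ∀ᵐ x ∂(α m), 0 ≤ x ∧ x ≤ Amax)
    (hJ : ∀ n ω, S.IsJTWSA V (fun m => S.Q A R D (n * S.T) m ω) (fun m => R m n ω) (D n ω))
    {ε : ℝ} (hε : 0 < ε) (hcap : (fun m => ∫ x, x ∂(α m) + ε) ∈ S.capacityRegion.{u})
    {Ω' : Type u} [MeasurableSpace Ω'] {μ' : Measure Ω'} {A' R' : Fin M → ℕ → Ω' → ℝ}
    {D' : ℕ → Ω' → Decision M L} (h' : S.IsNetwork α μ' A' R') (hF' : S.IsFeasible μ' A' R' D') :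
    S.avgEnergy μ D ≤ S.avgEnergy μ' D' +
      ENNReal.ofReal ((M * S.T ^ 2 * (Rmax ^ 2 + Amax ^ 2) / 2) / V) := by
  have hT : (0 : ℝ) < S.T := by exact_mod_cast S.T_pos
  -- Any fixed `δ` in `(0, T * ε)` would do: only a finite bound `x` on the queue averages is needed
  -- to absorb the error term below.
  obtain ⟨C, hC⟩ := h.sum_integral_Q_le_of_isJTWSA hD hV.le hR hA hJ hcap
    (half_pos (mul_pos hT hε)) (half_lt_self (mul_pos hT hε))
  have h0 := fun τ m => h.integral_Q_nonneg (D := D) hA τ m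
  set x := (M * S.T ^ 2 * (Rmax ^ 2 + Amax ^ 2) / 2 + V * (M * S.T * S.Es)) /
    (S.T * ε - S.T * ε / 2)
  set B : ℝ := M * S.T ^ 2 * (Rmax ^ 2 + Amax ^ 2) / 2 with hB
  have key : ∀ δ : ℝ, 0 < δ → S.avgEnergy μ D ≤ S.avgEnergy μ' D' + ENNReal.ofReal δ
      + ENNReal.ofReal (B / V) + ENNReal.ofReal (δ * (x / V)) := by
    intro δ hδ
    obtain ⟨s, ν, hs, hsm, -, hν⟩ := h'.exists_average_service hF' hR (h.integrable_arrival hA)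
      (fun m => (hA m).mono fun _ hx => hx.1) hδ
    set e := M * S.T * S.Esleep + (S.Es - S.Esleep) * ν
    have hle : S.avgEnergy μ D ≤ ENNReal.ofReal (e + B / V + δ * (x / V)) := by
      refine h.avgEnergy_le hD
        (C := (δ * C + ∑ m, ∫ ω, S.Q A R D (0 * S.T) m ω ^ 2 / 2 ∂μ) / V) fun N => ?_
      have := sum_range_le_of_telescoping
        (l := fun n => ∑ m, ∫ ω, S.Q A R D (n * S.T) m ω ^ 2 / 2 ∂μ)
        (a := fun n => V * (M * S.T * S.Esleep
          + (S.Es - S.Esleep) * ∑ m, ∫ ω, (S.sessions (D n ω m) : ℝ) ∂μ))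
        (c := fun n => B + V * e + δ * ∑ m, ∫ ω, S.Q A R D (n * S.T) m ω ∂μ)
        (fun n => Finset.sum_nonneg fun m _ => integral_nonneg fun ω => by positivity)
        (fun n => by
          have hd := h.expected_drift_le hD hR hA (hJ n) (hs V)
          have h1 : ∑ m, (∫ ω, S.Q A R D (n * S.T) m ω ∂μ) * (S.T * ∫ x, x ∂(α m) - s m) ≤
              δ * ∑ m, ∫ ω, S.Q A R D (n * S.T) m ω ∂μ := by
            rw [Finset.mul_sum]
            refine Finset.sum_le_sum fun m _ => ?_
            have h3 : S.T * ∫ x, x ∂(α m) - s m ≤ δ := by linarith [hsm m]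
            exact (mul_le_mul_of_nonneg_left h3 (h0 _ m)).trans (le_of_eq (by ring))
          linarith) N
      rw [Finset.sum_add_distrib, ← Finset.mul_sum, ← Finset.mul_sum, Finset.sum_const,
        Finset.card_range, nsmul_eq_mul] at this
      have h6 := mul_le_mul_of_nonneg_left (hC N) hδ.le
      rw [← mul_le_mul_iff_right₀ hV]
      refine (this.trans (add_le_add_left (add_le_add_right h6 _) _)).trans (le_of_eq ?_)
      field_simp
      ring
    refine hle.trans (ENNReal.ofReal_add_le.trans ?_)
    exact add_le_add_left (ENNReal.ofReal_add_le.trans (add_le_add_left hν _)) _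
  have hlim : Tendsto (fun δ : ℝ => S.avgEnergy μ' D' + ENNReal.ofReal δ
      + ENNReal.ofReal (B / V) + ENNReal.ofReal (δ * (x / V))) (nhdsWithin 0 (Set.Ioi 0))
      (nhds (S.avgEnergy μ' D' + ENNReal.ofReal 0
        + ENNReal.ofReal (B / V) + ENNReal.ofReal (0 * (x / V)))) := by
    refine Tendsto.mono_left (Continuous.tendsto ?_ 0) nhdsWithin_le_nhds
    exact ((continuous_const.add ENNReal.continuous_ofReal).add continuous_const).add
      (ENNReal.continuous_ofReal.comp (continuous_id.mul continuous_const))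
  have := ge_of_tendsto hlim (eventually_mem_nhdsWithin.mono fun δ hδ => key δ hδ)
  simpa using this

end IsNetwork

end System

end TWT

theorem theorem1 {M L : ℕ} (S : TWT.System M L)
    (V Rmax Amax : ℝ) (hV : 0 < V) (hR : ∀ r ∈ S.rates, r ≤ Rmax)
    (α : Fin M → Measure ℝ) (hA : ∀ m, ∀ᵐ x ∂(α m), 0 ≤ x ∧ x ≤ Amax)
    (lam : Fin M → ℝ) (hlam : ∀ m, lam m = ∫ x, x ∂(α m)) :
    (lam ∈ interior (S.capacityRegion.{u}) →
      ∃ ε : ℝ, 0 < ε ∧ (fun m => lam m + ε) ∈ S.capacityRegion.{u}) ∧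
    ∀ ε : ℝ, 0 < ε → (fun m => lam m + ε) ∈ S.capacityRegion.{u} →
      ∀ (Ω : Type u) [MeasurableSpace Ω] (μ : Measure Ω) (A R : Fin M → ℕ → Ω → ℝ)
        (D : ℕ → Ω → TWT.Decision M L),
        S.IsNetwork α μ A R → S.IsCausal μ A R D →
        (∀ n ω, S.IsJTWSA V (fun m => S.Q A R D (n * S.T) m ω) (fun m => R m n ω) (D n ω)) →
        S.optEnergy.{u} α ≠ ⊤ ∧
        S.avgEnergy μ D ≤ S.optEnergy.{u} α +
          ENNReal.ofReal ((M * S.T ^ 2 * (Rmax ^ 2 + Amax ^ 2) / 2) / V) ∧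
        S.avgQueue μ A R D ≤
          ENNReal.ofReal ((M * S.T ^ 2 * (Rmax ^ 2 + Amax ^ 2) / 2 + V * (M * S.T * S.Es)) / ε) := by
  refine ⟨fun hint => ?_, fun ε hε hcap Ω _ μ A R D h hD hJ => ?_⟩
  · have ht : Tendsto (fun ε : ℝ => fun m => lam m + ε) (nhdsWithin 0 (Set.Ioi 0)) (nhds lam) := by
      have hc : Continuous (fun ε : ℝ => fun m => lam m + ε) := by fun_prop
      have := hc.tendsto 0
      simp only [add_zero] at this
      exact this.mono_left nhdsWithin_le_nhds
    obtain ⟨ε, hε1, hε2⟩ := ((ht.eventually (mem_interior_iff_mem_nhds.1 hint)).and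
      eventually_mem_nhdsWithin).exists
    exact ⟨ε, hε2, hε1⟩
  · obtain rfl : lam = fun m => ∫ x, x ∂(α m) := funext hlam
    have hF := h.isFeasible_of_isJTWSA hD hV.le hR hA hJ hε hcap
    refine ⟨?_, ?_, h.avgQueue_le_of_isJTWSA hD hV.le hR hA hJ hε hcap⟩
    · exact ne_top_of_le_ne_top (h.avgEnergy_lt_top hD).ne
        (sInf_le ⟨Ω, _, μ, A, R, D, h, hF, rfl⟩)
    -- Moving the constant to the left makes this a lower bound for an infimum, to be checked
    -- against each competitor.
    · rw [← tsub_le_iff_right]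
      refine le_sInf ?_
      rintro _ ⟨Ω', _, μ', A', R', D', h', hF', rfl⟩
      rw [tsub_le_iff_right]
      exact h.avgEnergy_le_of_isJTWSA hD hV hR hA hJ hε hcap h' hF'
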